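/- **Setting.** A network $\mathcal G$ has a finite set $\mathcal C$ of nodes and a finite set of arrows; each node has a node-type, each arrow $e$ has an arrow-type, a head $\mathcal H(e)\in\mathcal C$ and a tail $\mathcal T(e)\in\mathcal C$. The input set of a node $c$ is $I(c)=\{e:\mathcal H(e)=c\}$. An input isomorphism $\beta:I(c)\to I(d)$ is an arrow-type preserving bijection, where $c,d$ have the same node-type. State equivalence $\sim_S$ is the equivalence relation on $\mathcal C$ generated by $c\sim_S d$ and $\mathcal T(e)\sim_S\mathcal T(\beta(e))$ for all input isomorphisms $\beta:I(c)\to I(d)$ and all $e\in I(c)$. Each node has a node space $P_c=\mathbb R^{k_c}$, $k_c\ge 1$, with $P_c=P_d$ whenever $c\sim_S d$; let $P=\prod_c P_c$ with $\|x\|=\max_c\|x_c\|$ (Euclidean norms on the $P_c$). A map $f:P\to P$ is admissible if there are maps $\hat f_c$ such that $f_c(x)=\hat f_c\big(x_c,(x_{\mathcal T(e)})_{e\in I(c)}\big)$ and, for every input isomorphism $\beta:I(c)\to I(d)$, $\hat f_d\big(v,(w_e)_{e\in I(d)}\big)=\hat f_c\big(v,(w_{\beta(e)})_{e\in I(c)}\big)$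 identically. A colouring $\bowtie$ is an equivalence relation on $\mathcal C$ such that $c\bowtie d$ implies $c\sim_S d$. It is balanced if for all $c\bowtie d$ there is an input isomorphism $\beta:I(c)\to I(d)$ with $\mathcal T(e)\bowtie\mathcal T(\beta(e))$ for all $e\in I(c)$. Put $\Delta_{\bowtie}=\{x\in P: c\bowtie d\Rightarrow x_c=x_d\}$. Equalities $x_c=x_d$ are considered only for $c\sim_S d$. Let $f$ be an admissible $C^\infty$ map and let $\mathbb X=\{x(t):t\in\mathbb R\}$ be a (non-constant) periodic orbit of $\dot x=f(x)$ with period $T$. It is hyperbolic if its only Floquet multiplier on the unit circle is a simple multiplier $1$. A perturbation is an admissible $C^\infty$ map $p$ with $\|p\|_1=\sup_{x\in P}\max(\|p(x)\|,\|\mathrm Dp(x)\|)<\infty$; for hyperbolic $\mathbb X$ and small $\|p\|_1$ let $\tilde x^p$ be the perturbed periodic orbit, that is, the locally unique periodic orbit of $\dot x=f(x)+p(x)$ near $\mathbb X$ with period near $T$. *Strong hyperbolicity.* For a set $\mathcal R$ of representatives of $\bowtie$ let $[c]\in\mathcal R$ be the representative of $c$. The induced ODE on $P^{\mathcal R}=\prod_{r\in\mathcal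 R}P_r$ is $\dot u_r=f_r\big((u_{[c]})_{c\in\mathcal C}\big)$, $r\in\mathcal R$, and the curve induced by $x(t)$ is $x^{\mathcal R}(t)=(x_r(t))_{r\in\mathcal R}$. The orbit $\mathbb X$ is strongly hyperbolic if it is hyperbolic and for every colouring $\bowtie$ with $\mathbb X\subseteq\Delta_{\bowtie}$ (so that $x^{\mathcal R}$ is an orbit of the induced ODE) there is a set $\mathcal R$ of representatives such that, for arbitrarily small perturbations $p$ ($p=0$ allowed), the curve induced by $\tilde x^p$ is a hyperbolic periodic orbit of the induced ODE of $f+p$. *Local rigidity.* The colouring $\bowtie$ is a locally rigid synchrony pattern of $\mathbb X$ on an open time interval around $t_0$ if there are $\varepsilon>0$ and $t^*>0$ such that for all perturbations $p$ with $\|p\|_1<\varepsilon$ the orbit $\tilde x^p$, with $\tilde x^p(t_0)$ in a fixed Poincaré section through $x(t_0)$, is hyperbolic, and for all $t$ with $|t-t_0|<t^*$ and all nodes $c\sim_S d$ $$\tilde x^p_c(t)=\tilde x^p_d(t)\iff c\bowtie d .$$ **Corollary 10.3.** Let $\mathbb X$ be a strongly hyperbolic periodic orbit of a $\mathcal G$-admissible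 ODE $\dot x=f(x)$, and suppose that $\bowtie$ is a locally rigid synchrony pattern of $\mathbb X$ on some non-empty open time interval. Then the entire orbit has synchrony pattern $\bowtie$, that is, for all nodes $c\sim_S d$, $$c\bowtie d\iff x_c(t)=x_d(t)\ \text{ for all } t\in\mathbb R,$$ and $\bowtie$ is balanced. -/

import Mathlib

open scoped ContDiff

noncomputable section

/-! ### Hyperbolic periodic orbits of vector fields -/

section Dynamics

variable {E : Type*} [NormedAddCommGroup E] [NormedSpace ℝ E]

/-- `x` is a (non-constant) solution of `ẋ = f(x)`, defined for all times, with period `T > 0`.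
The period need not be minimal. -/
structure IsPeriodicOrbit (f : E → E) (x : ℝ → E) (T : ℝ) : Prop where
  pos : 0 < T
  solution : ∀ t, HasDerivAt x (f (x t)) t
  periodic : ∀ t, x (t + T) = x t
  nonconstant : ∃ s t, x s ≠ x t

/-- `Φ` is the fundamental solution of the variational equation `Φ' = Df(x(t)) Φ`, `Φ(0) = id`,
along `x`. -/
def IsFundamentalSolution (f : E → E) (x : ℝ → E) (Φ : ℝ → E →L[ℝ] E) : Prop :=
  Φ 0 = ContinuousLinearMap.id ℝ E ∧
    ∀ t, HasDerivAt Φ ((fderiv ℝ f (x t)).comp (Φ t)) t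

/-- The linear map `M` has exactly one complex eigenvalue on the unit circle, counted with
algebraic multiplicity, and that eigenvalue is `1`. -/
def HasOnlySimpleUnitMultiplier [FiniteDimensional ℝ E] (M : E →L[ℝ] E) : Prop :=
  (((M : E →ₗ[ℝ] E).charpoly).map (algebraMap ℝ ℂ)).rootMultiplicity 1 = 1 ∧
    ∀ z : ℂ, (((M : E →ₗ[ℝ] E).charpoly).map (algebraMap ℝ ℂ)).IsRoot z → ‖z‖ = 1 → z = 1

/-- A hyperbolic periodic orbit: among the Floquet multipliers, that is, the eigenvalues of the
monodromy map `Φ(T)`, only a simple eigenvalue `1` lies on the unit circle. -/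
def IsHyperbolicPeriodicOrbit [FiniteDimensional ℝ E] (f : E → E) (x : ℝ → E) (T : ℝ) : Prop :=
  IsPeriodicOrbit f x T ∧
    ∃ Φ : ℝ → E →L[ℝ] E, IsFundamentalSolution f x Φ ∧ HasOnlySimpleUnitMultiplier (Φ T)

/-- The `C¹` norm `sup_x max (‖p(x)‖, ‖Dp(x)‖)`, with value `∞` if `p` is not `C¹`-bounded. -/
def c1Norm (p : E → E) : ENNReal :=
  ⨆ x, max ‖p x‖ₑ ‖fderiv ℝ p x‖ₑ

/-- `y` is a periodic orbit of `g`, of period `T'`, that is `η`-near to the `T`-periodic orbit `x`: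
the periods differ by less than `η`, and so do `y(t)` and `x(t)` during one period of `x`
starting at time `t₀`. -/
structure IsNearbyPeriodicOrbit (g : E → E) (x : ℝ → E) (T t₀ η : ℝ) (y : ℝ → E) (T' : ℝ) :
    Prop where
  isPeriodicOrbit : IsPeriodicOrbit g y T'
  period_near : |T' - T| < η
  near : ∀ t ∈ Set.Icc t₀ (t₀ + T), ‖y t - x t‖ < η

end Dynamics

/-! ### Networks -/

/-- A network with nodes `C` and arrows `A`: a node-type for each node, an arrow-type for each
arrow, and a head and a tail node for each arrow. Multiple arrows and self-loops are allowed. -/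
structure Network (C A : Type*) where
  nodeType : Setoid C
  arrowType : Setoid A
  head : A → C
  tail : A → C

namespace Network

variable {C A : Type*} (G : Network C A)

/-- The input set `I(c)`: all arrows with head `c`. -/
abbrev Input (c : C) : Type _ := {a : A // G.head a = c}

/-- The set `B(c,d)` of input isomorphisms: type-preserving bijections `I(c) → I(d)`, where
`c` and `d` have the same node-type. -/
structure InputIso (c d : C) where
  toEquiv : G.Input c ≃ G.Input d
  nodeType_rel : G.nodeType c d
  arrowType_rel : ∀ a, G.arrowType a.1 (toEquiv a).1

/-- The equalities of node spaces that are forced directly by an input isomorphism `β : I(c) → I(d)`: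
`P_c = P_d`, and `P_{T(e)} = P_{T(β(e))}` for all `e ∈ I(c)`. -/
inductive ForcedEq : C → C → Prop
  | node {c d : C} (β : G.InputIso c d) : ForcedEq c d
  | tail {c d : C} (β : G.InputIso c d) (e : G.Input c) :
      ForcedEq (G.tail e.1) (G.tail (β.toEquiv e).1)

/-- State equivalence `∼_S`: the equivalence relation generated by the forced equalities. -/
def StateEquiv (c d : C) : Prop := Relation.EqvGen G.ForcedEq c d

theorem stateEquiv_of_inputIso {c d : C} (β : G.InputIso c d) : G.StateEquiv c d :=
  .rel _ _ (.node β)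

theorem stateEquiv_tail {c d : C} (β : G.InputIso c d) (e : G.Input c) :
    G.StateEquiv (G.tail e.1) (G.tail (β.toEquiv e).1) :=
  .rel _ _ (.tail β e)

/-- A choice of node spaces `P_c = ℝ^{k_c}`, given by the dimensions `k_c ≥ 1`, such that
state-equivalent nodes have the same node space. -/
structure NodeSpaces where
  dim : C → ℕ
  dim_pos : ∀ c, 0 < dim c
  dim_eq : ∀ c d, G.StateEquiv c d → dim c = dim d

/-- A colouring of the nodes, viewed as the equivalence relation "same colour". Nodes of the same
colour have to be state-equivalent. -/
structure Colouring where
  rel : Setoid C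
  stateEquiv : ∀ c d, rel c d → G.StateEquiv c d

variable {G}

/-- A colouring is balanced if any two nodes of the same colour are related by a colour-preserving
input isomorphism. -/
def Colouring.IsBalanced (K : G.Colouring) : Prop :=
  ∀ c d, K.rel c d → ∃ β : G.InputIso c d, ∀ e : G.Input c,
    K.rel (G.tail e.1) (G.tail (β.toEquiv e).1)

/-- A set `R` of representatives of a colouring, through the map `c ↦ [c]` that sends a node to the
representative of its colour. -/
structure Colouring.Representatives (K : G.Colouring) where
  bracket : C → C
  bracket_rel : ∀ c, K.rel (bracket c) c
  bracket_eq : ∀ c d, K.rel c d → bracket c = bracket d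

/-- The set `R` itself: `r ∈ R` if and only if `[r] = r`. -/
abbrev Colouring.Representatives.Carrier {K : G.Colouring} (R : K.Representatives) : Type _ :=
  {r : C // R.bracket r = r}

namespace NodeSpaces

variable (V : G.NodeSpaces)

/-- The node space `P_c`, with the Euclidean norm. -/
abbrev Space (c : C) : Type := EuclideanSpace ℝ (Fin (V.dim c))

/-- The state space `P`, the product of the node spaces. It carries the norm
`‖x‖ = max_c ‖x_c‖`. -/
abbrev State : Type _ := ∀ c, V.Space c

/-- The identification of the equal node spaces of state-equivalent nodes, coordinate by
coordinate. -/
def transport {c d : C} (h : G.StateEquiv c d) : V.Space c ≃ₗᵢ[ℝ] V.Space d :=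
  LinearIsometryEquiv.piLpCongrLeft 2 ℝ ℝ (finCongr (V.dim_eq c d h))

/-- Admissible maps: `f_c(x) = f̂_c(x_c, x_{T(c)})`, where `x_{T(c)}` is the tuple of states of the
tail nodes of the arrows in `I(c)`, and
`f̂_d(x_d, x_{T(d)}) = f̂_c(x_d, β^* x_{T(d)})` for all input isomorphisms `β : I(c) → I(d)`. -/
def IsAdmissible (f : V.State → V.State) : Prop :=
  ∃ F : ∀ c, V.Space c → (∀ e : G.Input c, V.Space (G.tail e.1)) → V.Space c,
    (∀ x c, f x c = F c (x c) (fun e => x (G.tail e.1))) ∧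
    ∀ (c d : C) (β : G.InputIso c d) (v : V.Space d)
      (w : ∀ e : G.Input d, V.Space (G.tail e.1)),
      F d v w = V.transport (G.stateEquiv_of_inputIso β)
        (F c ((V.transport (G.stateEquiv_of_inputIso β)).symm v)
          (fun e => (V.transport (G.stateEquiv_tail β e)).symm (w (β.toEquiv e))))

/-- Synchrony of the nodes `c` and `d` in the state `x`: they are state-equivalent, and
`x_c = x_d`. -/
def Synchronous (x : V.State) (c d : C) : Prop :=
  ∃ h : G.StateEquiv c d, V.transport h (x c) = x d

/-- The polydiagonal of a colouring: nodes of the same colour have the same state. -/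
def polydiagonal (K : G.Colouring) : Set V.State :=
  {x | ∀ c d, K.rel c d → V.Synchronous x c d}

/-- `K` is the global synchrony pattern of the orbit `x`:
`c` and `d` have the same colour if and only if `x_c(t) = x_d(t)` for all `t`. -/
def IsGlobalSynchronyPattern (K : G.Colouring) (x : ℝ → V.State) : Prop :=
  ∀ c d, K.rel c d ↔ ∀ t, V.Synchronous (x t) c d

/-- The state space `P^R` of the quasi-quotient network: the product of the `P_r` for `r ∈ R`. -/
abbrev RedState {K : G.Colouring} (R : K.Representatives) : Type _ :=
  ∀ r : R.Carrier, V.Space r.1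

/-- The point of `P` whose component at the node `c` is `u_{[c]}`. -/
def lift {K : G.Colouring} (R : K.Representatives) (u : V.RedState R) : V.State := fun c =>
  V.transport (K.stateEquiv _ _ (R.bracket_rel c))
    (u ⟨R.bracket c, R.bracket_eq _ _ (R.bracket_rel c)⟩)

/-- The right-hand side of the induced ODE `u̇_r = f_r(u_r, u_{[T(r)]})`, `r ∈ R`. -/
def inducedField {K : G.Colouring} (R : K.Representatives) (f : V.State → V.State) :
    V.RedState R → V.RedState R :=
  fun u r => f (V.lift R u) r.1

/-- The induced curve `x^R(t) = (x_r(t))_{r ∈ R}`. -/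
def inducedCurve {K : G.Colouring} (R : K.Representatives) (x : ℝ → V.State) :
    ℝ → V.RedState R :=
  fun t r => x t r.1

section Rigidity

variable [Fintype C] [DecidableEq C]

/-- The perturbations: smooth `C¹`-bounded admissible maps `p` with `‖p‖₁ < ε`. -/
structure IsPerturbation (ε : ℝ) (p : V.State → V.State) : Prop where
  admissible : V.IsAdmissible p
  contDiff : ContDiff ℝ ∞ p
  small : c1Norm p < ENNReal.ofReal ε

/-- Strong hyperbolicity of the periodic orbit `x` of `f` for the colouring `K`: the orbit is
hyperbolic and, for a suitable set `R` of representatives, there are arbitrarily small admissible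
perturbations `p` such that the perturbed orbit `y` induces a hyperbolic periodic orbit `y^R` of the
induced ODE of `f + p`. (The perturbation `p = 0` is allowed.)

The induced curve is an orbit of the induced ODE only because of the synchrony relations of `K`, so
an orbit has an induced orbit for `K` only if it lies in the polydiagonal of `K`; for other
colourings the requirement is void. -/
def IsStronglyHyperbolicFor (K : G.Colouring) (f : V.State → V.State) (x : ℝ → V.State)
    (T : ℝ) : Prop :=
  IsHyperbolicPeriodicOrbit f x T ∧
    ((∀ t, x t ∈ V.polydiagonal K) →
      ∃ R : K.Representatives, ∀ δ > 0, ∃ p, V.IsPerturbation δ p ∧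
        ∃ y T', IsNearbyPeriodicOrbit (f + p) x T 0 δ y T' ∧
          IsHyperbolicPeriodicOrbit (V.inducedField R (f + p)) (V.inducedCurve R y) T')

/-- Strong hyperbolicity: strong hyperbolicity for every colouring. -/
def IsStronglyHyperbolic (f : V.State → V.State) (x : ℝ → V.State) (T : ℝ) : Prop :=
  ∀ K : G.Colouring, V.IsStronglyHyperbolicFor K f x T

/-- `K` is a locally rigid synchrony pattern of the orbit `x` at `x(t₀)`. For some `ε > 0` and
`t' > 0`, and for all admissible perturbations `p` with `‖p‖₁ < ε`, the perturbed periodic orbit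
`y` is hyperbolic, and `y_c(t) = y_d(t)` if and only if `c` and `d` have the same colour, for all
`t` with `|t - t₀| < t'`.

The perturbed orbit is the periodic orbit of `f + p` near `x` (at distance less than some `η`), with
time parametrized so that at time `t₀` it lies in a fixed Poincaré section through `x(t₀)`, here a
hyperplane `{z | ℓ z = ℓ (x(t₀))}` transverse to the orbit. -/
def IsLocallyRigidSynchronyPattern (K : G.Colouring) (f : V.State → V.State) (x : ℝ → V.State)
    (T t₀ : ℝ) : Prop :=
  ∃ ℓ : V.State →L[ℝ] ℝ, ℓ (f (x t₀)) ≠ 0 ∧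
    ∃ η > 0, ∃ ε > 0, ∃ t' > 0, ∀ p, V.IsPerturbation ε p →
      ∀ y T', IsNearbyPeriodicOrbit (f + p) x T t₀ η y T' → ℓ (y t₀) = ℓ (x t₀) →
        IsHyperbolicPeriodicOrbit (f + p) y T' ∧
          ∀ t, |t - t₀| < t' → ∀ c d, V.Synchronous (y t) c d ↔ K.rel c d

end Rigidity

end NodeSpaces

end Network

end

/-! Write `Δ` for the polydiagonal of `K` and `γ` for the orbit, rescaled so that one period has
length 1. The proof linearizes in the perturbation, shows that the linear responses force `K` to be
balanced, and then uses the flow-invariance of `Δ`.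

Linear response. Periodic orbits of `f + ε p` that satisfy a phase condition are zeros of a map on
`C([0,1]) × ℝ` (curve and period). Since 1 is an algebraically simple Floquet multiplier, the
linearization is bijective, so the implicit function theorem gives a branch of perturbed orbits,
differentiable in `ε`. By rigidity the branch stays in `Δ` on a short time interval, hence so does
its derivative `v`. It solves `v' = T (Df(γ) v + p(γ)) + ρ f(γ)`, and `v`, `ρ` are bounded by the
`L¹` norm of `p` along `γ`.

Kicks. Suppose the input state of a node `q` is not constant on the interval. At a suitable time `s`
its value is met, up to input isomorphism, only on a null set of times. Narrowing bumps around this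
value have `L¹` norm tending to 0 but a fixed value at time `s`, so `v(s)` and `ρ` tend to 0 while
`v'(s)` tends to `T p(γ(s))`. Hence the projection of any `d ∈ Δ` to the colour-preserving input
class of `q` lies in `Δ`.

Constant input states. On the set of the remaining nodes, with projection `π`, the equation becomes
autonomous: `π v' = M v + T π p`. Let `π'` be the complementary projection. Repeated differentiation
and kicks show that `M ^ k` maps every `v'(s)` and `π' Δ` into `Δ`. Let `U` be the largest
`M`-invariant subspace of `Δ`. Bump perturbations then put the class projections of `Δ` into `U + M
Δ`, so `Δ ≤ U + M Δ`, and a dimension count gives equality.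

So all class projections preserve `Δ`. Applied to a vector with no zero component, this says that
nodes of equal colour are in the same input class, i.e. `K` is balanced. Then `Δ` is flow-invariant,
and periodicity spreads the synchrony to all times. The key steps are `exists_linearResponse`,
`apply_nodeProjection_mem` and `isBalanced_of_responses`. -/

noncomputable section

open Set Filter Topology unitInterval MeasureTheory

/-! ### Curves on the unit interval: integration and superposition operators -/

section FunctionSpace

variable {E : Type*} [NormedAddCommGroup E]

/-- The extension of a curve on `[0, 1]` to `ℝ` that is constant on either side. -/
def extendCurve (h : C(I, E)) (s : ℝ) : E := h (projIcc 0 1 zero_le_one s)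

theorem continuous_extendCurve (h : C(I, E)) : Continuous (extendCurve h) :=
  h.continuous.comp continuous_projIcc

@[simp] theorem extendCurve_coe (h : C(I, E)) (s : I) : extendCurve h s = h s := by
  simp [extendCurve]

theorem extendCurve_of_mem (h : C(I, E)) {s : ℝ} (hs : s ∈ Icc (0 : ℝ) 1) :
    extendCurve h s = h ⟨s, hs⟩ := by
  simp [extendCurve, projIcc_of_mem _ hs]

theorem norm_extendCurve_le (h : C(I, E)) (s : ℝ) : ‖extendCurve h s‖ ≤ ‖h‖ :=
  h.norm_coe_le_norm _

variable [NormedSpace ℝ E]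

/-- The operator `h ↦ ∫₀ˢ h` on curves on `[0, 1]`. -/
def primitive : C(I, E) →L[ℝ] C(I, E) :=
  LinearMap.mkContinuous
    { toFun := fun h => ⟨fun s => ∫ r in (0 : ℝ)..s, extendCurve h r,
        (intervalIntegral.continuous_primitive
          (fun a b => (continuous_extendCurve h).intervalIntegrable a b) 0).comp
          continuous_subtype_val⟩
      map_add' := fun h k => by
        ext s
        exact intervalIntegral.integral_add
          ((continuous_extendCurve h).intervalIntegrable _ _)
          ((continuous_extendCurve k).intervalIntegrable _ _)
      map_smul' := fun c h => by
        ext s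
        exact intervalIntegral.integral_smul c (extendCurve h) }
    1 (fun h => by
      rw [ContinuousMap.norm_le _ (by positivity)]
      intro s
      have := intervalIntegral.norm_integral_le_of_norm_le_const (a := (0 : ℝ)) (b := (s : ℝ))
        (f := extendCurve h) (C := ‖h‖) (fun r _ => norm_extendCurve_le h r)
      refine this.trans ?_
      rw [mul_comm]
      have h1 : |(s : ℝ) - 0| ≤ 1 := by
        rw [sub_zero, abs_of_nonneg s.2.1]; exact s.2.2
      gcongr)

theorem primitive_apply (h : C(I, E)) (s : I) :
    primitive h s = ∫ r in (0 : ℝ)..s, extendCurve h r := rfl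

/-- The `L¹` bound, rather than the sup bound, is what makes the response to a narrow bump small
although its height is fixed. -/
theorem norm_primitive_le (h : C(I, E)) :
    ‖primitive h‖ ≤ ∫ r in (0 : ℝ)..1, ‖extendCurve h r‖ := by
  rw [ContinuousMap.norm_le _
    (intervalIntegral.integral_nonneg zero_le_one fun _ _ => norm_nonneg _)]
  intro s
  refine (intervalIntegral.norm_integral_le_integral_norm s.2.1).trans ?_
  exact intervalIntegral.integral_mono_interval le_rfl s.2.1 s.2.2
    (Eventually.of_forall fun _ => norm_nonneg _)
    ((continuous_extendCurve h).norm.intervalIntegrable _ _)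

/-- Pointwise application of a curve of linear maps. -/
def pointwiseApply (A : C(I, E →L[ℝ] E)) : C(I, E) →L[ℝ] C(I, E) :=
  LinearMap.mkContinuous
    { toFun := fun v => ⟨fun s => A s (v s), A.continuous.clm_apply v.continuous⟩
      map_add' := fun h k => by ext s; simp
      map_smul' := fun c h => by ext s; simp }
    ‖A‖ (fun v => by
      rw [ContinuousMap.norm_le _ (by positivity)]
      intro s
      exact ((A s).le_opNorm (v s)).trans
        (mul_le_mul (A.norm_coe_le_norm s) (v.norm_coe_le_norm s) (norm_nonneg _) (norm_nonneg A)))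

@[simp] theorem pointwiseApply_apply (A : C(I, E →L[ℝ] E)) (v : C(I, E)) (s : I) :
    pointwiseApply A v s = A s (v s) := rfl

/-- The constant curves. -/
def constCurve : E →L[ℝ] C(I, E) :=
  LinearMap.mkContinuous
    { toFun := fun a => ContinuousMap.const I a
      map_add' := fun h k => by ext s; simp
      map_smul' := fun c h => by ext s; simp }
    1 (fun v => by
      rw [ContinuousMap.norm_le _ (by positivity)]
      intro s
      simp)

@[simp] theorem constCurve_apply (a : E) (s : I) : constCurve a s = a := rfl

/-- Superposition with a `C¹` map is strictly differentiable on the space of curves. -/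
theorem hasStrictFDerivAt_superposition {f : E → E} (hf : ContDiff ℝ 1 f) (y : C(I, E)) :
    HasStrictFDerivAt (fun z : C(I, E) => (⟨f, hf.continuous⟩ : C(E, E)).comp z)
      (pointwiseApply ⟨fun s => fderiv ℝ f (y s),
        (hf.continuous_fderiv one_ne_zero).comp y.continuous⟩) y := by
  rw [hasStrictFDerivAt_iff_isLittleO, Asymptotics.isLittleO_iff]
  intro c hc
  have hK : IsCompact (range y) := isCompact_range y.continuous
  -- Compactness of the range gives one `δ` for all `s`; the mean value inequality for `f - Df(y s)`
  -- is then uniform in `s`.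
  have huc := hK.uniformContinuousAt_of_continuousAt (fderiv ℝ f)
    (fun a _ => (hf.continuous_fderiv one_ne_zero).continuousAt) (Metric.dist_mem_uniformity hc)
  obtain ⟨δ, hδ, H⟩ := Metric.mem_uniformity_dist.1 huc
  have hball : ∀ᶠ q : C(I, E) × C(I, E) in 𝓝 (y, y),
      q.1 ∈ Metric.ball y δ ∧ q.2 ∈ Metric.ball y δ := by
    have := prod_mem_nhds (Metric.ball_mem_nhds y hδ) (Metric.ball_mem_nhds y hδ)
    filter_upwards [this] with q hq using hq
  filter_upwards [hball] with q hq
  rw [ContinuousMap.norm_le _ (by positivity)]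
  intro s
  have hm : ∀ z : C(I, E), z ∈ Metric.ball y δ → z s ∈ Metric.ball (y s) δ := fun z hz =>
    lt_of_le_of_lt (ContinuousMap.dist_apply_le_dist s) hz
  have key := (convex_ball (y s) δ).norm_image_sub_le_of_norm_hasFDerivWithin_le'
    (f := f) (f' := fderiv ℝ f) (φ := fderiv ℝ f (y s)) (C := c)
    (fun w _ => ((hf.differentiable one_ne_zero) w).hasFDerivAt.hasFDerivWithinAt)
    (fun w hw => by
      have := H (a := y s) (b := w) (by rw [dist_comm]; exact hw) (mem_range_self s)
      rw [← dist_eq_norm, dist_comm]; exact le_of_lt this)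
    (hm _ hq.2) (hm _ hq.1)
  refine key.trans ?_
  have := (q.1 - q.2).norm_coe_le_norm s
  simp only [ContinuousMap.sub_apply] at this
  gcongr

end FunctionSpace

/-! ### Linear differential equations and the linearized boundary value problem -/

section LinearODE

variable {E : Type*} [NormedAddCommGroup E] [NormedSpace ℝ E]

theorem exists_lipschitz_on_Icc {A : ℝ → E →L[ℝ] E} (hA : Continuous A) (a b : ℝ) :
    ∃ k : NNReal, ∀ t ∈ Icc a b, LipschitzWith k (A t) := by
  obtain ⟨k, hk⟩ := isCompact_Icc.exists_bound_of_continuousOn (s := Icc a b) hA.continuousOn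
  refine ⟨k.toNNReal, fun t ht => (A t).lipschitz.weaken ?_⟩
  rw [← NNReal.coe_le_coe, coe_nnnorm]
  exact (hk t ht).trans (Real.le_coe_toNNReal k)

theorem linearODE_unique_Icc {A : ℝ → E →L[ℝ] E} (hA : Continuous A) {u w : ℝ → E} {a b : ℝ}
    (hu : ContinuousOn u (Icc a b)) (hw : ContinuousOn w (Icc a b))
    (hu' : ∀ t ∈ Ico a b, HasDerivWithinAt u (A t (u t)) (Ici t) t)
    (hw' : ∀ t ∈ Ico a b, HasDerivWithinAt w (A t (w t)) (Ici t) t) (h : u a = w a) :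
    EqOn u w (Icc a b) := by
  obtain ⟨k, hk⟩ := exists_lipschitz_on_Icc hA a b
  exact ODE_solution_unique_of_mem_Icc_right (v := fun t z => A t z) (s := fun _ => univ)
    (fun t ht => (hk t (Ico_subset_Icc_self ht)).lipschitzOnWith) hu hu' (fun _ _ => trivial) hw hw'
    (fun _ _ => trivial) h

theorem linearODE_unique {A : ℝ → E →L[ℝ] E} (hA : Continuous A) {u w : ℝ → E}
    (hu : ∀ t, HasDerivAt u (A t (u t)) t) (hw : ∀ t, HasDerivAt w (A t (w t)) t) {t₁ : ℝ}
    (h : u t₁ = w t₁) (t : ℝ) : u t = w t := by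
  set a := min t t₁ - 1
  set b := max t t₁ + 1
  have h1 : t ∈ Ioo a b := by constructor <;> simp only [a, b] <;> grind
  have h2 : t₁ ∈ Ioo a b := by constructor <;> simp only [a, b] <;> grind
  obtain ⟨k, hk⟩ := exists_lipschitz_on_Icc hA a b
  exact ODE_solution_unique_of_mem_Ioo (v := fun t z => A t z) (s := fun _ => univ)
    (fun t ht => (hk t (Ioo_subset_Icc_self ht)).lipschitzOnWith) h2
    (fun t _ => ⟨hu t, trivial⟩) (fun t _ => ⟨hw t, trivial⟩) h h1

/-- The linearization at a periodic orbit of the boundary value problem for periodic orbits: `A` is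
the linearized vector field, `φ` the vector field along the orbit, and `ℓ` the phase condition. -/
def linearization (A : C(I, E →L[ℝ] E)) (φ : C(I, E)) (ℓ : E →L[ℝ] ℝ) :
    C(I, E) × ℝ →L[ℝ] C(I, E) × ℝ :=
  ContinuousLinearMap.prod
    (ContinuousLinearMap.fst ℝ C(I, E) ℝ -
      constCurve ∘L ContinuousMap.evalCLM ℝ (1 : I) ∘L ContinuousLinearMap.fst ℝ C(I, E) ℝ -
      primitive ∘L (pointwiseApply A ∘L ContinuousLinearMap.fst ℝ C(I, E) ℝ +
        (ContinuousLinearMap.snd ℝ C(I, E) ℝ).smulRight φ))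
    (ℓ ∘L ContinuousMap.evalCLM ℝ (0 : I) ∘L ContinuousLinearMap.fst ℝ C(I, E) ℝ)

theorem linearization_apply (A : C(I, E →L[ℝ] E)) (φ : C(I, E)) (ℓ : E →L[ℝ] ℝ)
    (v : C(I, E)) (ρ : ℝ) : linearization A φ ℓ (v, ρ) =
      (v - constCurve (v 1) - primitive (pointwiseApply A v + ρ • φ), ℓ (v 0)) := rfl

variable [CompleteSpace E]

theorem hasDerivAt_integral_extendCurve (h : C(I, E)) (s : ℝ) :
    HasDerivAt (fun s => ∫ r in (0 : ℝ)..s, extendCurve h r) (extendCurve h s) s :=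
  intervalIntegral.integral_hasDerivAt_right ((continuous_extendCurve h).intervalIntegrable _ _)
    (continuous_extendCurve h).aestronglyMeasurable.stronglyMeasurableAtFilter
    (continuous_extendCurve h).continuousAt

end LinearODE

/-! ### Simple multiplier 1 makes the linearization bijective -/

section Nondegenerate

variable {E : Type*} [NormedAddCommGroup E] [NormedSpace ℝ E] [FiniteDimensional ℝ E]

/-- A linear periodic system with fundamental matrix `Ψ`, whose monodromy map `N` has an
algebraically simple eigenvalue `1` with eigenvector `e`, has nondegenerate linearization. -/
theorem bijective_linearization {A : ℝ → E →L[ℝ] E} (hA : Continuous A) {Ψ : ℝ → E →L[ℝ] E}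
    (hΨ : ∀ s, HasDerivAt Ψ ((A s).comp (Ψ s)) s) (hinj : ∀ s, Function.Injective (Ψ s))
    {N : E →L[ℝ] E} {e : E} (hN : Ψ 1 = (Ψ 0).comp N) (he : N e = e)
    (hsimple : ∀ a, N (N a - a) - (N a - a) = 0 → ∃ κ : ℝ, a = κ • e)
    {ℓ : E →L[ℝ] ℝ} (hℓ : ℓ (Ψ 0 e) ≠ 0) (A' : C(I, E →L[ℝ] E)) (hA' : ∀ s : I, A' s = A s)
    (φ : C(I, E)) (hφ : ∀ s : I, φ s = Ψ s e) :
    Function.Bijective (linearization A' φ ℓ) := by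
  have he0 : e ≠ 0 := by rintro rfl; simp at hℓ
  have hΨv : ∀ s (a : E), HasDerivAt (fun s => Ψ s a) (A s (Ψ s a)) s := fun s a => by
    simpa using (hΨ s).clm_apply (hasDerivAt_const s a)
  have hsΨ : ∀ s (ρ : ℝ), HasDerivAt (fun s : ℝ => (ρ * s) • Ψ s e)
      (A s ((ρ * s) • Ψ s e) + ρ • Ψ s e) s := fun s ρ => by
    refine (((hasDerivAt_id s).const_mul ρ).smul (hΨv s e)).congr_deriv ?_
    simp
  have hcΨ : Continuous Ψ := continuous_iff_continuousAt.2 fun s => (hΨ s).continuousAt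
  have hsurj0 : Function.Surjective (Ψ 0) :=
    (LinearMap.injective_iff_surjective (f := (Ψ 0 : E →ₗ[ℝ] E))).1 (hinj 0)
  -- the bordered monodromy matrix
  let Q : E × ℝ →ₗ[ℝ] E × ℝ :=
    (((N : E →ₗ[ℝ] E) - LinearMap.id) ∘ₗ LinearMap.fst ℝ E ℝ +
      (LinearMap.snd ℝ E ℝ).smulRight e).prod
      (((ℓ.comp (Ψ 0) : E →L[ℝ] ℝ) : E →ₗ[ℝ] ℝ) ∘ₗ LinearMap.fst ℝ E ℝ)
  have hQ : ∀ a ρ, Q (a, ρ) = (N a - a + ρ • e, ℓ (Ψ 0 a)) := fun a ρ => rfl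
  have hQinj : Function.Injective Q := by
    rw [injective_iff_map_eq_zero]
    rintro ⟨a, ρ⟩ h
    rw [hQ, Prod.mk_eq_zero] at h
    obtain ⟨h1, h2⟩ := h
    have h3 : N a - a = -(ρ • e) := eq_neg_of_add_eq_zero_left h1
    -- `N a - a` is a multiple of the fixed vector `e`, so `a` is killed by `(N - 1)²` and lies on
    -- the line of `e`; the phase condition then gives `κ = 0`.
    obtain ⟨κ, rfl⟩ := hsimple a (by rw [h3]; simp [he])
    have hκ : κ = 0 := by simpa [hℓ] using h2
    subst hκ
    simpa [he0] using h3
  have hQsurj : Function.Surjective Q := LinearMap.injective_iff_surjective.1 hQinj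
  constructor
  · rw [injective_iff_map_eq_zero]
    rintro ⟨v, ρ⟩ h
    rw [linearization_apply, Prod.mk_eq_zero] at h
    obtain ⟨h1, h2⟩ := h
    set g : C(I, E) := pointwiseApply A' v + ρ • φ with hg
    -- The integral equation supplies a differentiable version of `v` on the whole line.
    set V : ℝ → E := fun s => v 1 + ∫ r in (0 : ℝ)..s, extendCurve g r with hV
    have hVv : ∀ s : I, V s = v s := fun s => by
      have := DFunLike.congr_fun h1 s
      simp only [ContinuousMap.sub_apply, constCurve_apply, primitive_apply,
        ContinuousMap.zero_apply] at this
      simp only [hV]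
      rw [sub_sub, sub_eq_zero] at this
      exact this.symm
    have hVd : ∀ s, HasDerivAt V (extendCurve g s) s := fun s =>
      (hasDerivAt_integral_extendCurve g s).const_add _
    obtain ⟨a, ha⟩ := hsurj0 (V 0)
    -- `(ρ s) Ψ(s) e` is a particular solution for the forcing `ρ φ`; removing it leaves the
    -- homogeneous equation.
    have hVd' : ∀ s ∈ Icc (0 : ℝ) 1, HasDerivAt (fun s => V s - (ρ * s) • Ψ s e)
        (A s (V s - (ρ * s) • Ψ s e)) s := fun s hs => by
      refine ((hVd s).sub (hsΨ s ρ)).congr_deriv ?_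
      rw [extendCurve_of_mem _ hs, hg]
      have hs1 := hVv ⟨s, hs⟩
      simp only [ContinuousMap.add_apply, pointwiseApply_apply, ContinuousMap.smul_apply, hA', hφ,
        map_sub] at hs1 ⊢
      rw [hs1]; abel
    have key : EqOn (fun s => V s - (ρ * s) • Ψ s e) (fun s => Ψ s a) (Icc 0 1) :=
      linearODE_unique_Icc hA
        (fun s hs => (hVd' s hs).continuousAt.continuousWithinAt)
        (fun s _ => (hΨv s a).continuousAt.continuousWithinAt)
        (fun s hs => (hVd' s (Ico_subset_Icc_self hs)).hasDerivWithinAt)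
        (fun s _ => (hΨv s a).hasDerivWithinAt) (by simp [ha])
    have hV01 : V 0 = V 1 := by
      have h1' := hVv 1
      simp only [Icc.coe_one] at h1'
      rw [h1']
      simp [hV]
    have hk1 := key (right_mem_Icc.2 zero_le_one)
    simp only [hN, ContinuousLinearMap.comp_apply, mul_one, ← hV01, ← ha, he] at hk1
    have hk2 : N a - a + ρ • e = 0 := by
      apply hinj 0
      rw [map_add, map_sub, map_smul, map_zero, ← hk1]; abel
    have hk3 : ℓ (Ψ 0 a) = 0 := by
      have h0 := hVv 0
      simp only [Icc.coe_zero] at h0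
      rw [ha, h0, h2]
    have := hQinj (a₁ := (a, ρ)) (a₂ := 0) (by rw [hQ, hk2, hk3]; simp)
    obtain ⟨rfl, rfl⟩ := Prod.mk_eq_zero.1 this
    refine Prod.mk_eq_zero.2 ⟨?_, rfl⟩
    ext s
    have := key s.2
    simp only [zero_mul, zero_smul, sub_zero, map_zero] at this
    rw [← hVv, this]; rfl
  · rintro ⟨h, r⟩
    let Ei : ∀ s, E ≃L[ℝ] E := fun s =>
      (LinearEquiv.ofInjectiveEndo (Ψ s : E →ₗ[ℝ] E) (hinj s)).toContinuousLinearEquiv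
    have hEi : ∀ s, (Ei s : E →L[ℝ] E) = Ψ s := fun s => by ext; rfl
    have hinvc : Continuous fun s => (Ψ s).inverse := by
      refine continuous_iff_continuousAt.2 fun s => ?_
      have h1 : ContinuousAt ContinuousLinearMap.inverse (Ψ s) := by
        rw [← hEi s]
        exact (contDiffAt_map_inverse (𝕜 := ℝ) (n := 0) (Ei s)).continuousAt
      exact h1.comp hcΨ.continuousAt
    have hinv : ∀ s b, Ψ s ((Ψ s).inverse b) = b := fun s b => by
      rw [← hEi s, ContinuousLinearMap.inverse_equiv]; simp
    -- The datum `h` is only continuous, so the solution is sought as `v = u + h` with `u' = A (u +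
    -- h) + ρ φ`; variation of constants gives `u`, with `k` as integrand.
    set k : C(I, E) := ⟨fun s => (Ψ s).inverse (A s (h s)),
      (hinvc.comp continuous_subtype_val).clm_apply
        ((hA.comp continuous_subtype_val).clm_apply h.continuous)⟩ with hk
    set q : ℝ → E := fun s => ∫ r in (0 : ℝ)..s, extendCurve k r with hq
    have hq0 : q 0 = 0 := by simp [hq]
    -- This right-hand side encodes the closing condition `u 0 = u 1 + h 1` and the phase condition
    -- `ℓ (u 0 + h 0) = r`.
    obtain ⟨⟨a, ρ⟩, haρ⟩ := hQsurj (-(N (q 1)) - (Ψ 0).inverse (h 1), r - ℓ (h 0))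
    rw [hQ, Prod.mk.injEq] at haρ
    obtain ⟨ha1, ha2⟩ := haρ
    set u : ℝ → E := fun s => Ψ s (a + q s) + (ρ * s) • Ψ s e with hu
    have hud : ∀ s ∈ Icc (0 : ℝ) 1,
        HasDerivAt u (A s (u s + extendCurve h s) + ρ • Ψ s e) s := fun s hs => by
      have h1 := (hΨ s).clm_apply ((hasDerivAt_integral_extendCurve k s).const_add a)
      refine (h1.add (hsΨ s ρ)).congr_deriv ?_
      rw [extendCurve_of_mem _ hs, extendCurve_of_mem _ hs, hk]
      simp only [ContinuousMap.coe_mk, hinv, hu, map_add, ContinuousLinearMap.comp_apply, hq]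
      abel
    have huc : Continuous u := by
      have hqc : Continuous q := continuous_iff_continuousAt.2 fun s =>
        (hasDerivAt_integral_extendCurve k s).continuousAt
      exact (hcΨ.clm_apply (continuous_const.add hqc)).add
        ((continuous_const.mul continuous_id).smul (hcΨ.clm_apply continuous_const))
    set v : C(I, E) := ⟨fun s => u s, huc.comp continuous_subtype_val⟩ + h with hv
    have hvu : ∀ s : I, v s = u s + h s := fun s => rfl
    have hu01 : u 0 = u 1 + h 1 := by
      have : Ψ 0 (N a - a + ρ • e) = -(Ψ 0 (N (q 1))) - h 1 := by
        rw [ha1, map_sub, map_neg, hinv]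
      simp only [map_add, map_sub, map_smul] at this
      simp only [hu, hq0, hN, ContinuousLinearMap.comp_apply, he, map_add, mul_zero, zero_smul,
        map_zero, mul_one, add_zero]
      linear_combination (norm := module) -this
    refine ⟨(v, ρ), ?_⟩
    rw [linearization_apply, Prod.mk.injEq]
    constructor
    · have hint : ∀ s : I, primitive (pointwiseApply A' v + ρ • φ) s = u s - u 0 := fun s => by
        rw [primitive_apply]
        refine intervalIntegral.integral_eq_sub_of_hasDerivAt (f := u) (fun t ht => ?_)
          ((continuous_extendCurve _).intervalIntegrable _ _)
        rw [uIcc_of_le s.2.1] at ht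
        have ht' : t ∈ Icc (0 : ℝ) 1 := ⟨ht.1, ht.2.trans s.2.2⟩
        convert hud t ht' using 1
        rw [extendCurve_of_mem _ ht', extendCurve_of_mem _ ht']
        simp [hA', hφ, hvu]
      ext s
      simp only [ContinuousMap.sub_apply, constCurve_apply, hint, hvu, Icc.coe_one, hu01]
      abel
    · rw [hvu, map_add]
      simp only [Icc.coe_zero, hu, hq0, ha2, add_zero, mul_zero, zero_smul]
      abel

end Nondegenerate

/-! ### Floquet multipliers of a hyperbolic orbit -/

section Monodromy

variable {E : Type*} [NormedAddCommGroup E] [NormedSpace ℝ E] [FiniteDimensional ℝ E]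

/-- Root multiplicity does not change from `ℝ` to `ℂ`, so the real generalized eigenspace of 1 is a
line, spanned by `e`; a vector killed by `(N - 1)²` lies in it. -/
theorem HasOnlySimpleUnitMultiplier.exists_smul_eq {N : E →L[ℝ] E}
    (hN : HasOnlySimpleUnitMultiplier N) {e : E} (he : N e = e) (he0 : e ≠ 0) {a : E}
    (ha : N (N a - a) - (N a - a) = 0) : ∃ κ : ℝ, a = κ • e := by
  have h1 : Module.finrank ℝ (Module.End.maxGenEigenspace (N : E →ₗ[ℝ] E) 1) = 1 := by
    rw [LinearMap.finrank_maxGenEigenspace_eq, ← hN.1]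
    exact (Polynomial.eq_rootMultiplicity_map (algebraMap ℝ ℂ).injective 1).trans (by simp)
  have hem : e ∈ Module.End.maxGenEigenspace (N : E →ₗ[ℝ] E) 1 := by
    rw [Module.End.mem_maxGenEigenspace]
    exact ⟨1, by simp [he]⟩
  have ham : a ∈ Module.End.maxGenEigenspace (N : E →ₗ[ℝ] E) 1 := by
    rw [Module.End.mem_maxGenEigenspace]
    exact ⟨2, by simpa [pow_two] using ha⟩
  obtain ⟨κ, hκ⟩ := (finrank_eq_one_iff_of_nonzero' (⟨e, hem⟩ :
    Module.End.maxGenEigenspace (N : E →ₗ[ℝ] E) 1) (by simpa [Subtype.ext_iff] using he0)).1 h1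
    ⟨a, ham⟩
  exact ⟨κ, (congrArg Subtype.val hκ).symm⟩

variable {f : E → E} {x : ℝ → E} {T : ℝ}

omit [FiniteDimensional ℝ E] in
theorem IsPeriodicOrbit.continuous (hx : IsPeriodicOrbit f x T) : Continuous x :=
  continuous_iff_continuousAt.2 fun t => (hx.solution t).continuousAt

/-- One period of the orbit `x`, starting at time `t₀` and rescaled to `[0, 1]`. -/
def orbitCurve (x : ℝ → E) (hx : Continuous x) (T t₀ : ℝ) : C(I, E) :=
  ⟨fun s => x (t₀ + T * s), by fun_prop⟩

omit [NormedSpace ℝ E] [FiniteDimensional ℝ E] in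
@[simp] theorem orbitCurve_apply (hx : Continuous x) (t₀ : ℝ) (s : I) :
    orbitCurve x hx T t₀ s = x (t₀ + T * s) := rfl

omit [NormedSpace ℝ E] [FiniteDimensional ℝ E] in
theorem extendCurve_orbitCurve (hx : Continuous x) (t₀ : ℝ) {s : ℝ} (hs : s ∈ Icc (0 : ℝ) 1) :
    extendCurve (orbitCurve x hx T t₀) s = x (t₀ + T * s) := by
  rw [extendCurve_of_mem _ hs]; rfl

/-- The curve of linearizations `T • Df` along one rescaled period. -/
def variationalCurve (hf : ContDiff ℝ 1 f) (x : ℝ → E) (hx : Continuous x) (T t₀ : ℝ) :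
    C(I, E →L[ℝ] E) :=
  ⟨fun s => T • fderiv ℝ f (orbitCurve x hx T t₀ s), ((hf.continuous_fderiv one_ne_zero).comp
    (orbitCurve x hx T t₀).continuous).const_smul T⟩

/-- Superposition with a continuous map. -/
def superposition (g : E → E) (hg : Continuous g) (y : C(I, E)) : C(I, E) :=
  (⟨g, hg⟩ : C(E, E)).comp y

omit [NormedSpace ℝ E] [FiniteDimensional ℝ E] in
@[simp] theorem superposition_apply (g : E → E) (hg : Continuous g) (y : C(I, E)) (s : I) :
    superposition g hg y s = g (y s) := rfl

/-- The velocity `f(x(t))` solves the variational equation, so `f(x(0))` is the eigenvector of the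
monodromy map for 1. Starting at `t₀` only replaces `Φ` by its shift. -/
theorem IsHyperbolicPeriodicOrbit.bijective_linearization (hf : ContDiff ℝ 1 f)
    (hx : IsHyperbolicPeriodicOrbit f x T) {t₀ : ℝ} {ℓ : E →L[ℝ] ℝ} (hℓ : ℓ (f (x t₀)) ≠ 0) :
    Function.Bijective (linearization (variationalCurve hf x hx.1.continuous T t₀)
      (superposition f hf.continuous (orbitCurve x hx.1.continuous T t₀)) ℓ) := by
  obtain ⟨hper, Φ, ⟨hΦ0, hΦ⟩, hM⟩ := hx
  have hxc := hper.continuous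
  have hBc : Continuous fun t => fderiv ℝ f (x t) := (hf.continuous_fderiv one_ne_zero).comp hxc
  have hΦv : ∀ (a : E) t, HasDerivAt (fun t => Φ t a) (fderiv ℝ f (x t) (Φ t a)) t := fun a t => by
    simpa using (hΦ t).clm_apply (hasDerivAt_const t a)
  have hinj : ∀ t, Function.Injective (Φ t) := fun t a b hab => by
    simpa [hΦ0] using linearODE_unique hBc (hΦv a) (hΦv b) hab 0
  have hfx : ∀ t, Φ t (f (x 0)) = f (x t) := fun t =>
    linearODE_unique hBc (hΦv _) (fun t =>
      ((hf.differentiable one_ne_zero) (x t)).hasFDerivAt.comp_hasDerivAt t (hper.solution t))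
      (t₁ := 0) (by simp [hΦ0]) t
  -- Both sides solve the same equation because its coefficients have period `T`, and they agree at
  -- time 0.
  have hper' : ∀ t, Φ (t + T) = (Φ t).comp (Φ T) := fun t => by
    ext a
    refine linearODE_unique (u := fun t => Φ (t + T) a) (w := fun t => Φ t (Φ T a)) hBc
      (fun t => ?_) (hΦv _) (t₁ := 0) (by simp [hΦ0]) t
    have := (hΦv a (t + T)).comp_add_const t T
    rwa [hper.periodic] at this
  have hfT : Φ T (f (x 0)) = f (x 0) := by
    rw [hfx, ← zero_add T, hper.periodic]
  have hne : f (x 0) ≠ 0 := by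
    intro h
    have := hfx t₀
    rw [h, map_zero] at this
    rw [← this, map_zero] at hℓ
    exact hℓ rfl
  refine _root_.bijective_linearization (A := fun s => T • fderiv ℝ f (x (t₀ + T * s)))
    (Ψ := fun s => Φ (t₀ + T * s)) (N := Φ T) (e := f (x 0)) ?_ ?_ (fun s => hinj _) ?_ hfT
    (fun a ha => hM.exists_smul_eq hfT hne ha) ?_ _ (fun s => rfl) _ (fun s => ?_)
  · exact (hBc.comp (by fun_prop : Continuous fun s : ℝ => t₀ + T * s)).const_smul T
  · intro s
    have h1 : HasDerivAt (fun s : ℝ => t₀ + T * s) T s := by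
      simpa using ((hasDerivAt_id s).const_mul T).const_add t₀
    refine ((hΦ (t₀ + T * s)).scomp s h1).congr_deriv ?_
    ext; simp
  · simp [hper']
  · simpa [hfx] using hℓ
  · simp [hfx]

end Monodromy

/-! ### Perturbed periodic orbits from the implicit function theorem -/

section Persistence

variable {E : Type*} [NormedAddCommGroup E] [NormedSpace ℝ E]

/-- `y` closes up and is a solution of `ẏ = g(y)` after rescaling time by `τ`. -/
def IsClosedSolution (g : E → E) (hg : Continuous g) (y : C(I, E)) (τ : ℝ) : Prop :=
  y = constCurve (y 1) + τ • primitive (superposition g hg y)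

/-- The boundary value problem for periodic orbits of `f + ε p` with phase condition. -/
def boundaryMap (f p : E → E) (hf : Continuous f) (hp : Continuous p) (ℓ : E →L[ℝ] ℝ)
    (q : ℝ × (C(I, E) × ℝ)) : C(I, E) × ℝ :=
  (q.2.1 - constCurve (q.2.1 1) -
    q.2.2 • primitive (superposition f hf q.2.1 + q.1 • superposition p hp q.2.1), ℓ (q.2.1 0))

theorem hasStrictFDerivAt_boundaryMap {f p : E → E} (hf : ContDiff ℝ 1 f) (hp : ContDiff ℝ 1 p)
    (ℓ : E →L[ℝ] ℝ) (y : C(I, E)) (τ : ℝ) (A : C(I, E →L[ℝ] E))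
    (hA : ∀ s, A s = τ • fderiv ℝ f (y s)) :
    ∃ G' : ℝ × (C(I, E) × ℝ) →L[ℝ] C(I, E) × ℝ,
      HasStrictFDerivAt (boundaryMap f p hf.continuous hp.continuous ℓ) G' (0, (y, τ)) ∧
      (∀ w, G' (0, w) = linearization A (superposition f hf.continuous y) ℓ w) ∧
      G' (1, 0) = (-(τ • primitive (superposition p hp.continuous y)), 0) := by
  have h1 : HasStrictFDerivAt (fun q : ℝ × (C(I, E) × ℝ) => q.2.1)
      (ContinuousLinearMap.fst ℝ _ _ ∘L ContinuousLinearMap.snd ℝ _ _) (0, (y, τ)) :=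
    (ContinuousLinearMap.fst ℝ C(I, E) ℝ ∘L
      ContinuousLinearMap.snd ℝ ℝ (C(I, E) × ℝ)).hasStrictFDerivAt
  have h2 : HasStrictFDerivAt (fun q : ℝ × (C(I, E) × ℝ) => q.2.2)
      (ContinuousLinearMap.snd ℝ _ _ ∘L ContinuousLinearMap.snd ℝ _ _) (0, (y, τ)) :=
    (ContinuousLinearMap.snd ℝ C(I, E) ℝ ∘L
      ContinuousLinearMap.snd ℝ ℝ (C(I, E) × ℝ)).hasStrictFDerivAt
  have h3 := HasStrictFDerivAt.comp (0, (y, τ)) (hasStrictFDerivAt_superposition hf y) h1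
  have h4 := HasStrictFDerivAt.comp (0, (y, τ)) (hasStrictFDerivAt_superposition hp y) h1
  have h5 := h3.add (hasStrictFDerivAt_fst.smul h4)
  have h6 := HasStrictFDerivAt.comp (0, (y, τ)) (primitive (E := E)).hasStrictFDerivAt h5
  have h7 := HasStrictFDerivAt.comp (0, (y, τ))
    (constCurve ∘L ContinuousMap.evalCLM ℝ (1 : I) : C(I, E) →L[ℝ] C(I, E)).hasStrictFDerivAt h1
  have h8 := HasStrictFDerivAt.comp (0, (y, τ))
    (ℓ ∘L ContinuousMap.evalCLM ℝ (0 : I) : C(I, E) →L[ℝ] ℝ).hasStrictFDerivAt h1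
  refine ⟨_, ((h1.sub h7).sub (h2.smul h6)).prodMk h8, ?_, ?_⟩
  · rintro ⟨v, ρ⟩
    have hAv : τ • pointwiseApply ⟨fun s => fderiv ℝ f (y s),
        (hf.continuous_fderiv one_ne_zero).comp y.continuous⟩ v = pointwiseApply A v := by
      ext s; simp [hA]
    rw [linearization_apply, ← hAv, map_add, map_smul, map_smul]
    refine Prod.ext ?_ ?_
    · simp [superposition]
    · simp
  · refine Prod.ext ?_ ?_
    · simp [superposition]
    · simp

variable [FiniteDimensional ℝ E]

/-- Persistence of a hyperbolic periodic orbit, with the derivative in the parameter. -/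
theorem IsHyperbolicPeriodicOrbit.exists_perturbed_curves {f : E → E} {x : ℝ → E} {T : ℝ}
    (hf : ContDiff ℝ 1 f) (hx : IsHyperbolicPeriodicOrbit f x T) {t₀ : ℝ} {ℓ : E →L[ℝ] ℝ}
    (hℓ : ℓ (f (x t₀)) ≠ 0) :
    ∃ S : C(I, E) →L[ℝ] C(I, E) × ℝ,
      (∀ h, linearization (variationalCurve hf x hx.1.continuous T t₀)
        (superposition f hf.continuous (orbitCurve x hx.1.continuous T t₀)) ℓ (S h) = (h, 0)) ∧
      ∀ (p : E → E) (hp : ContDiff ℝ 1 p), ∃ ψ : ℝ → C(I, E) × ℝ,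
        ψ 0 = (orbitCurve x hx.1.continuous T t₀, T) ∧
        HasDerivAt ψ (S (T • primitive (superposition p hp.continuous
          (orbitCurve x hx.1.continuous T t₀)))) 0 ∧
        ∀ᶠ ε in 𝓝 (0 : ℝ),
          IsClosedSolution (f + ε • p) (hf.continuous.add (hp.continuous.const_smul ε))
            (ψ ε).1 (ψ ε).2 ∧ ℓ ((ψ ε).1 0) = ℓ (x t₀) := by
  have hbij := hx.bijective_linearization hf hℓ
  have hper := hx.1
  set γ := orbitCurve x hx.1.continuous T t₀ with hγ
  set Λ := linearization (variationalCurve hf x hx.1.continuous T t₀)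
    (superposition f hf.continuous γ) ℓ with hΛ
  let Λe := ContinuousLinearEquiv.ofBijective Λ (LinearMap.ker_eq_bot.2 hbij.1)
    (LinearMap.range_eq_top.2 hbij.2)
  have hΛe : (Λe : C(I, E) × ℝ →L[ℝ] C(I, E) × ℝ) = Λ :=
    ContinuousLinearEquiv.coe_ofBijective Λ _ _
  refine ⟨(Λe.symm : C(I, E) × ℝ →L[ℝ] C(I, E) × ℝ) ∘L ContinuousLinearMap.inl ℝ _ _,
    fun h => ?_, fun p hp => ?_⟩
  · rw [← hΛe]; simp
  obtain ⟨G', hG', hG1, hG2⟩ := hasStrictFDerivAt_boundaryMap hf hp ℓ γ T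
    (variationalCurve hf x hx.1.continuous T t₀) (fun s => rfl)
  have hinr : G' ∘L ContinuousLinearMap.inr ℝ ℝ (C(I, E) × ℝ) = Λe := by
    rw [hΛe]
    refine ContinuousLinearMap.ext fun w => ?_
    simpa using hG1 w
  have hinv : (G' ∘L ContinuousLinearMap.inr ℝ ℝ (C(I, E) × ℝ)).IsInvertible := ⟨Λe, hinr.symm⟩
  refine ⟨hG'.implicitFunctionOfProdDomain hinv,
    (hG'.eventually_apply_eq_iff_implicitFunctionOfProdDomain hinv).self_of_nhds.1 rfl, ?_, ?_⟩
  · have h1 := (hG'.hasStrictFDerivAt_implicitFunctionOfProdDomain hinv).hasFDerivAt.hasDerivAt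
    refine h1.congr_deriv ?_
    rw [hinr, ContinuousLinearMap.inverse_equiv]
    simp only [ContinuousLinearMap.comp_apply, neg_apply,
      ContinuousLinearMap.inl_apply, hG2]
    rw [← map_neg]
    simp
  · filter_upwards [hG'.eventually_apply_implicitFunctionOfProdDomain hinv] with ε hε
    set w := hG'.implicitFunctionOfProdDomain hinv ε
    have h0 : boundaryMap f p hf.continuous hp.continuous ℓ (0, (γ, T)) = (0, ℓ (x t₀)) := by
      refine Prod.ext ?_ ?_
      · ext s
        have hint : T • ∫ r in (0 : ℝ)..s, extendCurve (superposition f hf.continuous γ) r =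
            x (t₀ + T * s) - x (t₀ + T * 0) := by
          rw [← intervalIntegral.integral_smul]
          refine intervalIntegral.integral_eq_sub_of_hasDerivAt (f := fun s => x (t₀ + T * s))
            (fun t ht => ?_) (((continuous_extendCurve _).const_smul T).intervalIntegrable _ _)
          rw [uIcc_of_le s.2.1] at ht
          have h1 : HasDerivAt (fun s : ℝ => t₀ + T * s) T t := by
            simpa using ((hasDerivAt_id t).const_mul T).const_add t₀
          rw [extendCurve_of_mem _ ⟨ht.1, ht.2.trans s.2.2⟩]
          exact (hper.solution (t₀ + T * t)).scomp t h1
        simp only [boundaryMap, zero_smul, add_zero, ContinuousMap.sub_apply, constCurve_apply,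
          ContinuousMap.smul_apply, primitive_apply, hint, ContinuousMap.zero_apply]
        simp only [hγ, orbitCurve_apply, Icc.coe_one, mul_one, mul_zero, add_zero, hper.periodic]
        abel
      · simp [boundaryMap, hγ]
    rw [h0] at hε
    have h1 := congrArg Prod.fst hε
    have h2 := congrArg Prod.snd hε
    refine ⟨?_, h2⟩
    simp only [boundaryMap] at h1
    rw [sub_sub, sub_eq_zero] at h1
    exact h1

/-- The periodic extension to `ℝ` of a curve on `[0, 1]`, with period `τ` and starting at `t₀`. -/
def unroll (y : C(I, E)) (τ t₀ t : ℝ) : E := extendCurve y (Int.fract ((t - t₀) / τ))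

omit [FiniteDimensional ℝ E] [NormedSpace ℝ E] in
theorem unroll_of_mem {y : C(I, E)} {τ : ℝ} (hτ : 0 < τ) (h01 : y 0 = y 1) (t₀ : ℝ) (s : I) :
    unroll y τ t₀ (t₀ + τ * s) = y s := by
  have : (t₀ + τ * s - t₀) / τ = s := by field_simp; ring
  rw [unroll, this]
  rcases s.2.2.lt_or_eq with h | h
  · rw [Int.fract_eq_self.2 ⟨s.2.1, h⟩, extendCurve_coe]
  · obtain rfl : s = 1 := Subtype.ext h
    rw [← h01]
    simp [extendCurve]

omit [FiniteDimensional ℝ E] in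
theorem IsClosedSolution.apply_zero {g : E → E} {hg : Continuous g} {y : C(I, E)} {τ : ℝ}
    (h : IsClosedSolution g hg y τ) : y 0 = y 1 := by
  have := DFunLike.congr_fun h 0
  simpa [primitive_apply] using this

omit [NormedSpace ℝ E] [FiniteDimensional ℝ E] in
theorem continuous_fract_extendCurve {y : C(I, E)} (h01 : y 0 = y 1) :
    Continuous fun s : ℝ => extendCurve y (Int.fract s) :=
  ContinuousOn.comp_fract'' (continuous_extendCurve y).continuousOn
    (by simpa [extendCurve] using h01)

/-- The delicate points are the integers, where the fractional part jumps. The periodic extension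
`Y` is continuous since `y` closes up, and it equals the primitive `Z`, which is differentiable
everywhere and periodic because the integral over one period contributes nothing. -/
theorem IsClosedSolution.hasDerivAt_fract {g : E → E} {hg : Continuous g} {y : C(I, E)} {τ : ℝ}
    (h : IsClosedSolution g hg y τ) (s : ℝ) :
    HasDerivAt (fun s : ℝ => extendCurve y (Int.fract s))
      (τ • g (extendCurve y (Int.fract s))) s := by
  have hc := continuous_fract_extendCurve h.apply_zero
  set Y := fun s : ℝ => extendCurve y (Int.fract s) with hY
  have hYper : Function.Periodic Y 1 := fun s => by simp [hY]
  have hgc : Continuous fun r => g (Y r) := hg.comp hc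
  set Z := fun s : ℝ => y 1 + τ • ∫ r in (0 : ℝ)..s, g (Y r) with hZ
  have hZI : ∀ s : I, Z s = y s := fun s => by
    have h1 := DFunLike.congr_fun h s
    rw [h1]
    simp only [hZ, ContinuousMap.add_apply, constCurve_apply, ContinuousMap.smul_apply,
      primitive_apply]
    congr 2
    refine intervalIntegral.integral_congr_ae ?_
    have hne : ∀ᵐ r : ℝ, r ≠ 1 := by
      rw [ae_iff]
      simp
    filter_upwards [hne] with r hr1 hr
    rw [uIoc_of_le s.2.1] at hr
    have hr' : r ∈ Icc (0 : ℝ) 1 := ⟨hr.1.le, hr.2.trans s.2.2⟩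
    simp only [hY]
    rw [Int.fract_eq_self.2 ⟨hr'.1, lt_of_le_of_ne hr'.2 hr1⟩, extendCurve_of_mem _ hr',
      extendCurve_of_mem _ hr']
    rfl
  have hZper : Function.Periodic Z 1 := fun s => by
    have h1 : ∫ r in (0 : ℝ)..(s + 1), g (Y r) =
        (∫ r in (0 : ℝ)..s, g (Y r)) + ∫ r in (0 : ℝ)..1, g (Y r) := by
      rw [← intervalIntegral.integral_add_adjacent_intervals
        (hgc.intervalIntegrable 0 s) (hgc.intervalIntegrable s (s + 1))]
      congr 1
      have hp : Function.Periodic (fun r => g (Y r)) 1 := fun r => congrArg g (hYper r)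
      simpa using hp.intervalIntegral_add_eq s 0
    have h2 : τ • ∫ r in (0 : ℝ)..1, g (Y r) = 0 := by
      have h3 : y 1 + τ • ∫ r in (0 : ℝ)..((1 : I) : ℝ), g (Y r) = y 1 := hZI 1
      exact add_eq_left.1 h3
    change y 1 + τ • ∫ r in (0 : ℝ)..(s + 1), g (Y r) = y 1 + τ • ∫ r in (0 : ℝ)..s, g (Y r)
    rw [h1, smul_add, h2, add_zero]
  have hZY : Y = Z := by
    ext s
    have h1 : Z (Int.fract s) = Z s := by
      have := hZper.sub_zsmul_eq (x := s) ⌊s⌋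
      simpa using this
    rw [← h1]
    have hm : Int.fract s ∈ Icc (0 : ℝ) 1 := ⟨Int.fract_nonneg s, (Int.fract_lt_one s).le⟩
    rw [hZI ⟨_, hm⟩]
    exact extendCurve_of_mem _ hm
  have : HasDerivAt Z (τ • g (Y s)) s :=
    ((intervalIntegral.integral_hasDerivAt_right (hgc.intervalIntegrable _ _)
      hgc.aestronglyMeasurable.stronglyMeasurableAtFilter hgc.continuousAt).const_smul τ).const_add _
  rwa [← hZY] at this

theorem IsClosedSolution.hasDerivAt_unroll {g : E → E} {hg : Continuous g} {y : C(I, E)} {τ : ℝ}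
    (h : IsClosedSolution g hg y τ) (hτ : 0 < τ) (t₀ t : ℝ) :
    HasDerivAt (unroll y τ t₀) (g (unroll y τ t₀ t)) t := by
  have h1 : HasDerivAt (fun t : ℝ => (t - t₀) / τ) (1 / τ) t :=
    ((hasDerivAt_id t).sub_const t₀).div_const τ
  refine ((h.hasDerivAt_fract ((t - t₀) / τ)).scomp t h1).congr_deriv ?_
  rw [smul_smul, one_div_mul_cancel hτ.ne', one_smul]; rfl

omit [NormedSpace ℝ E] [FiniteDimensional ℝ E] in
theorem unroll_add_period (y : C(I, E)) {τ : ℝ} (hτ : 0 < τ) (t₀ t : ℝ) :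
    unroll y τ t₀ (t + τ) = unroll y τ t₀ t := by
  have : (t + τ - t₀) / τ = (t - t₀) / τ + 1 := by field_simp; ring
  rw [unroll, unroll, this, Int.fract_add_one]

end Persistence

/-! ### Closed solutions as nearby orbits, and the linear response -/

section NearbyOrbits

variable {E : Type*} [NormedAddCommGroup E] [NormedSpace ℝ E]

variable {f : E → E} {x : ℝ → E} {T : ℝ}

theorem IsPeriodicOrbit.orbitCurve_fract (hx : IsPeriodicOrbit f x T) (t₀ r : ℝ) :
    extendCurve (orbitCurve x hx.continuous T t₀) (Int.fract r) = x (t₀ + T * r) := by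
  rw [extendCurve_orbitCurve _ _ ⟨Int.fract_nonneg r, (Int.fract_lt_one r).le⟩]
  have h := Function.Periodic.sub_zsmul_eq (f := x) (c := T) hx.periodic (x := t₀ + T * r) ⌊r⌋
  rw [← h]
  congr 1
  rw [Int.fract, zsmul_eq_mul]
  ring

theorem IsPeriodicOrbit.uniformContinuous [FiniteDimensional ℝ E] (hf : Continuous f)
    (hx : IsPeriodicOrbit f x T) : UniformContinuous x := by
  obtain ⟨k, hk⟩ := isCompact_Icc.exists_bound_of_continuousOn (s := Icc 0 T)
    (hf.comp hx.continuous).continuousOn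
  have hk' : ∀ t, ‖f (x t)‖ ≤ k := fun t => by
    obtain ⟨t', ht', h⟩ := Function.Periodic.exists_mem_Ico₀ (f := x) (c := T) hx.periodic hx.pos t
    rw [h]
    exact hk t' (Ico_subset_Icc_self ht')
  refine (lipschitzWith_of_nnnorm_deriv_le (C := k.toNNReal)
    (fun t => (hx.solution t).differentiableAt) fun t => ?_).uniformContinuous
  rw [(hx.solution t).deriv, ← NNReal.coe_le_coe, coe_nnnorm]
  exact (hk' t).trans (Real.le_coe_toNNReal k)

variable [FiniteDimensional ℝ E]

/-- Closed solutions near the orbit unroll to nearby periodic orbits. -/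
theorem IsPeriodicOrbit.eventually_isNearby (hf : Continuous f) (hx : IsPeriodicOrbit f x T)
    (t₀ : ℝ) {η : ℝ} (hη : 0 < η) :
    ∀ᶠ w in 𝓝 (orbitCurve x hx.continuous T t₀, T), ∀ (g : E → E) (hg : Continuous g),
      IsClosedSolution g hg w.1 w.2 →
        IsNearbyPeriodicOrbit g x T t₀ η (unroll w.1 w.2 t₀) w.2 := by
  have hT := hx.pos
  set γ := orbitCurve x hx.continuous T t₀ with hγ
  obtain ⟨δ, hδ, hδ'⟩ := Metric.uniformContinuous_iff.1 (hx.uniformContinuous hf) (η / 2)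
    (half_pos hη)
  obtain ⟨a, b, hab⟩ := hx.nonconstant
  have hex : ∀ a, ∃ s : I, γ s = x a := fun a => by
    refine ⟨⟨Int.fract ((a - t₀) / T), Int.fract_nonneg _, (Int.fract_lt_one _).le⟩, ?_⟩
    have := hx.orbitCurve_fract t₀ ((a - t₀) / T)
    rw [extendCurve_of_mem _ ⟨Int.fract_nonneg _, (Int.fract_lt_one _).le⟩] at this
    rw [this]
    congr 1
    field_simp
    ring
  obtain ⟨sa, ha⟩ := hex a
  obtain ⟨sb, hb⟩ := hex b
  have hev : ∀ s : I, Continuous fun w : C(I, E) × ℝ => w.1 s := fun s =>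
    (ContinuousMap.evalCLM ℝ s).continuous.comp continuous_fst
  have e1 : ∀ᶠ w in 𝓝 (γ, T), w.1 sa ≠ w.1 sb :=
    ((hev sa).continuousAt.prodMk (hev sb).continuousAt).eventually
      (isOpen_ne_fun continuous_fst continuous_snd |>.mem_nhds (by
        simpa only [mem_ofPred_eq, ha, hb] using hab))
  have e2 : ∀ᶠ w in 𝓝 (γ, T), 0 < w.2 :=
    continuous_snd.continuousAt.eventually (lt_mem_nhds hT)
  have e3 : ∀ᶠ w in 𝓝 (γ, T), |w.2 - T| < η := by
    have : ContinuousAt (fun w : C(I, E) × ℝ => |w.2 - T|) (γ, T) := by fun_prop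
    exact this.eventually (gt_mem_nhds (by simpa using hη))
  have e4 : ∀ᶠ w in 𝓝 (γ, T), ‖w.1 - γ‖ < η / 2 := by
    have : ContinuousAt (fun w : C(I, E) × ℝ => ‖w.1 - γ‖) (γ, T) := by fun_prop
    exact this.eventually (gt_mem_nhds (by simpa using hη))
  -- This bounds the time shift, over one period, that is caused by rescaling the perturbed period
  -- to `T`.
  have e5 : ∀ᶠ w in 𝓝 (γ, T), T * |T / w.2 - 1| < δ := by
    have : ContinuousAt (fun w : C(I, E) × ℝ => T * |T / w.2 - 1|) (γ, T) :=
      continuousAt_const.mul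
        ((continuousAt_const.div continuous_snd.continuousAt hT.ne').sub continuousAt_const).abs
    exact this.eventually (gt_mem_nhds (by simpa [hT.ne'] using hδ))
  filter_upwards [e1, e2, e3, e4, e5] with w h1 h2 h3 h4 h5 g hg hsol
  refine ⟨⟨h2, hsol.hasDerivAt_unroll h2 t₀, unroll_add_period _ h2 t₀,
    t₀ + w.2 * sa, t₀ + w.2 * sb, ?_⟩, h3, fun t ht => ?_⟩
  · rwa [unroll_of_mem h2 hsol.apply_zero, unroll_of_mem h2 hsol.apply_zero]
  · have k1 : ‖unroll w.1 w.2 t₀ t - x (t₀ + T * ((t - t₀) / w.2))‖ < η / 2 := by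
      rw [← hx.orbitCurve_fract]
      exact lt_of_le_of_lt ((w.1 - γ).norm_coe_le_norm
        (projIcc 0 1 zero_le_one (Int.fract ((t - t₀) / w.2)))) h4
    have k2 : ‖x (t₀ + T * ((t - t₀) / w.2)) - x t‖ < η / 2 := by
      rw [← dist_eq_norm]
      refine hδ' (lt_of_le_of_lt ?_ h5)
      rw [Real.dist_eq]
      have : t₀ + T * ((t - t₀) / w.2) - t = (t - t₀) * (T / w.2 - 1) := by ring
      rw [this, abs_mul, abs_of_nonneg (sub_nonneg.2 ht.1)]
      have : t - t₀ ≤ T := by linarith [ht.2]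
      gcongr
    calc _ = ‖(unroll w.1 w.2 t₀ t - x (t₀ + T * ((t - t₀) / w.2))) +
          (x (t₀ + T * ((t - t₀) / w.2)) - x t)‖ := by congr 1; abel
      _ ≤ _ := norm_add_le _ _
      _ < η := by linarith

/-- The linear response of a hyperbolic periodic orbit to perturbations of the vector field. If
all small multiples of a perturbation keep a piece of the orbit inside a subspace, then so does
the linear response. -/
theorem IsHyperbolicPeriodicOrbit.exists_linearResponse (hf : ContDiff ℝ 1 f)
    (hx : IsHyperbolicPeriodicOrbit f x T) {t₀ : ℝ} {ℓ : E →L[ℝ] ℝ} (hℓ : ℓ (f (x t₀)) ≠ 0) :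
    ∃ S : C(I, E) →L[ℝ] C(I, E) × ℝ,
      (∀ h, linearization (variationalCurve hf x hx.1.continuous T t₀)
        (superposition f hf.continuous (orbitCurve x hx.1.continuous T t₀)) ℓ (S h) = (h, 0)) ∧
      ∀ (p : E → E) (hp : ContDiff ℝ 1 p) (W : Submodule ℝ E) (t' : ℝ), 0 < t' → ∀ η > 0,
        (∀ t, |t - t₀| < t' → x t ∈ W) →
        (∀ᶠ ε in 𝓝[>] (0 : ℝ), ∀ y T', IsNearbyPeriodicOrbit (f + ε • p) x T t₀ η y T' →
          ℓ (y t₀) = ℓ (x t₀) → ∀ t, |t - t₀| < t' → y t ∈ W) →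
        ∀ s : I, 2 * T * s < t' →
          (S (T • primitive (superposition p hp.continuous
            (orbitCurve x hx.1.continuous T t₀)))).1 s ∈ W := by
  obtain ⟨S, hS, H⟩ := hx.exists_perturbed_curves hf hℓ
  refine ⟨S, hS, fun p hp W t' ht' η hη hxW hyW s hs => ?_⟩
  obtain ⟨ψ, hψ0, hψ, hψs⟩ := H p hp
  have hT := hx.1.pos
  have hψc : Tendsto ψ (𝓝[>] 0) (𝓝 (orbitCurve x hx.1.continuous T t₀, T)) := by
    rw [← hψ0]
    exact hψ.continuousAt.tendsto.mono_left nhdsWithin_le_nhds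
  have e1 := hψc.eventually (hx.1.eventually_isNearby hf.continuous t₀ hη)
  have e2 : ∀ᶠ ε in 𝓝[>] (0 : ℝ), 0 < (ψ ε).2 :=
    (continuous_snd.tendsto _).comp hψc |>.eventually (lt_mem_nhds hT)
  -- With the perturbed period below `2 T`, the parameter `s` stands for a time within `t'` of `t₀`,
  -- where `y` is known to lie in `W`.
  have e3 : ∀ᶠ ε in 𝓝[>] (0 : ℝ), (ψ ε).2 < 2 * T :=
    (continuous_snd.tendsto _).comp hψc |>.eventually (gt_mem_nhds (by simp; linarith))
  have hmem : ∀ᶠ ε in 𝓝[>] (0 : ℝ), (ψ ε).1 s ∈ W := by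
    filter_upwards [e1, e2, e3, hyW, nhdsWithin_le_nhds hψs] with ε h1 h2 h3 h4 h5
    have h01 := h5.1.apply_zero
    have k := h4 _ _ (h1 _ _ h5.1) (by
      have := unroll_of_mem h2 h01 t₀ 0
      simp only [Icc.coe_zero, mul_zero, add_zero] at this
      rw [this, h5.2]) (t₀ + (ψ ε).2 * s) (by
      rw [add_sub_cancel_left, abs_of_nonneg (mul_nonneg h2.le s.2.1)]
      exact lt_of_le_of_lt (mul_le_mul_of_nonneg_right h3.le s.2.1) hs)
    rwa [unroll_of_mem h2 h01] at k
  have hγW : (orbitCurve x hx.1.continuous T t₀) s ∈ W := by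
    refine hxW _ ?_
    have : 0 ≤ T * (s : ℝ) := mul_nonneg hT.le s.2.1
    rw [add_sub_cancel_left, abs_of_nonneg this]
    linarith
  have hd : HasDerivAt (fun ε => (ψ ε).1 s) ((S (T • primitive (superposition p hp.continuous
      (orbitCurve x hx.1.continuous T t₀)))).1 s) 0 :=
    (ContinuousMap.evalCLM ℝ s ∘L ContinuousLinearMap.fst ℝ C(I, E) ℝ).hasFDerivAt.comp_hasDerivAt
      0 hψ
  have hslope := (hasDerivAt_iff_tendsto_slope.1 hd).mono_left
    (nhdsWithin_mono (0 : ℝ)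
    (show Ioi (0 : ℝ) ⊆ {0}ᶜ from fun ε hε => (mem_Ioi.1 hε).ne'))
  refine W.closed_of_finiteDimensional.mem_of_tendsto hslope ?_
  filter_upwards [hmem] with ε hε
  rw [slope_def_module]
  refine W.smul_mem _ (W.sub_mem hε ?_)
  rw [hψ0]
  exact hγW

end NearbyOrbits

/-! ### Maps with finite `C¹` norm -/

/-- `g` and its derivative are bounded. -/
def IsC1Bounded {E F : Type*} [NormedAddCommGroup E] [NormedSpace ℝ E] [NormedAddCommGroup F]
    [NormedSpace ℝ F] (g : E → F) : Prop :=
  ∃ B, ∀ x, ‖g x‖ ≤ B ∧ ‖fderiv ℝ g x‖ ≤ B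

section C1Bounded

variable {E F : Type*} [NormedAddCommGroup E] [NormedSpace ℝ E] [NormedAddCommGroup F]
  [NormedSpace ℝ F]

theorem IsC1Bounded.nonneg_bound {g : E → F} (h : IsC1Bounded g) :
    ∃ B, 0 ≤ B ∧ ∀ x, ‖g x‖ ≤ B ∧ ‖fderiv ℝ g x‖ ≤ B := by
  obtain ⟨B, hB⟩ := h
  exact ⟨B, (norm_nonneg _).trans (hB 0).1, hB⟩

theorem isC1Bounded_const (a : F) : IsC1Bounded fun _ : E => a :=
  ⟨‖a‖, fun x => by simp⟩

theorem IsC1Bounded.add {g h : E → F} (hg : IsC1Bounded g) (hh : IsC1Bounded h)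
    (dg : Differentiable ℝ g) (dh : Differentiable ℝ h) : IsC1Bounded (g + h) := by
  obtain ⟨B, hB⟩ := hg
  obtain ⟨B', hB'⟩ := hh
  refine ⟨B + B', fun x => ⟨norm_add_le_of_le (hB x).1 (hB' x).1, ?_⟩⟩
  rw [fderiv_add (dg x) (dh x)]
  exact norm_add_le_of_le (hB x).2 (hB' x).2

theorem IsC1Bounded.const_smul {g : E → F} (hg : IsC1Bounded g) (dg : Differentiable ℝ g) (c : ℝ) :
    IsC1Bounded (c • g) := by
  obtain ⟨B, hB⟩ := hg
  refine ⟨‖c‖ * B, fun x => ⟨?_, ?_⟩⟩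
  · rw [Pi.smul_apply, norm_smul]
    exact mul_le_mul_of_nonneg_left (hB x).1 (norm_nonneg _)
  · rw [fderiv_const_smul (dg x), norm_smul]
    exact mul_le_mul_of_nonneg_left (hB x).2 (norm_nonneg _)

theorem IsC1Bounded.smul_const {g : E → ℝ} (hg : IsC1Bounded g) (dg : Differentiable ℝ g) (a : F) :
    IsC1Bounded fun x => g x • a := by
  obtain ⟨B, hB⟩ := hg
  refine ⟨B * ‖a‖, fun x => ⟨?_, ?_⟩⟩
  · rw [norm_smul]
    exact mul_le_mul_of_nonneg_right (hB x).1 (norm_nonneg _)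
  · rw [fderiv_smul_const (dg x), ContinuousLinearMap.norm_smulRight_apply]
    exact mul_le_mul_of_nonneg_right (hB x).2 (norm_nonneg _)

theorem IsC1Bounded.mul {g h : E → ℝ} (hg : IsC1Bounded g) (hh : IsC1Bounded h)
    (dg : Differentiable ℝ g) (dh : Differentiable ℝ h) : IsC1Bounded fun x => g x * h x := by
  obtain ⟨B, hB0, hB⟩ := hg.nonneg_bound
  obtain ⟨B', hB0', hB'⟩ := hh.nonneg_bound
  refine ⟨B * B' + B' * B, fun x => ⟨?_, ?_⟩⟩
  · rw [norm_mul]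
    have := mul_le_mul (hB x).1 (hB' x).1 (norm_nonneg _) hB0
    nlinarith
  · rw [fderiv_fun_mul (dg x) (dh x)]
    refine norm_add_le_of_le ?_ ?_
    · rw [norm_smul]
      exact mul_le_mul (hB x).1 (hB' x).2 (norm_nonneg _) hB0
    · rw [norm_smul]
      exact mul_le_mul (hB' x).1 (hB x).2 (norm_nonneg _) hB0'

theorem IsC1Bounded.finset_prod {ι : Type*} (s : Finset ι) {g : ι → E → ℝ}
    (hg : ∀ i, IsC1Bounded (g i)) (dg : ∀ i, Differentiable ℝ (g i)) :
    IsC1Bounded fun x => ∏ i ∈ s, g i x := by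
  classical
  suffices h : IsC1Bounded (fun x => ∏ i ∈ s, g i x) ∧
      Differentiable ℝ (fun x => ∏ i ∈ s, g i x) from h.1
  induction s using Finset.induction_on with
  | empty => simpa using isC1Bounded_const (E := E) (1 : ℝ)
  | insert i s his ih =>
    simp only [Finset.prod_insert his]
    exact ⟨(hg i).mul ih.1 (dg i) ih.2, (dg i).mul ih.2⟩

theorem IsC1Bounded.pi {ι : Type*} [Fintype ι] {X : ι → Type*} [∀ i, NormedAddCommGroup (X i)]
    [∀ i, NormedSpace ℝ (X i)] {g : E → ∀ i, X i} (hg : ∀ i, IsC1Bounded fun x => g x i)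
    (dg : ∀ i, Differentiable ℝ fun x => g x i) : IsC1Bounded g := by
  choose B hB0 hB using fun i => (hg i).nonneg_bound
  have hle : ∀ i, B i ≤ ∑ i, B i := fun i =>
    Finset.single_le_sum (fun j _ => hB0 j) (Finset.mem_univ i)
  have h0 : 0 ≤ ∑ i, B i := Finset.sum_nonneg fun j _ => hB0 j
  refine ⟨∑ i, B i, fun x => ⟨?_, ?_⟩⟩
  · exact (pi_norm_le_iff_of_nonneg h0).2 fun i => (hB i x).1.trans (hle i)
  · rw [fderiv_pi fun i => dg i x]
    refine ContinuousLinearMap.opNorm_le_bound _ h0 fun w => ?_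
    refine (pi_norm_le_iff_of_nonneg (by positivity)).2 fun i => ?_
    exact (ContinuousLinearMap.le_opNorm _ w).trans
      (mul_le_mul_of_nonneg_right ((hB i x).2.trans (hle i)) (norm_nonneg _))

theorem ContDiffBump.isC1Bounded [HasContDiffBump F] [FiniteDimensional ℝ F] {c : F}
    (φ : ContDiffBump c) (Λ : E →L[ℝ] F) : IsC1Bounded fun x => φ (Λ x) := by
  obtain ⟨B, hB⟩ := (φ.hasCompactSupport.fderiv ℝ).exists_bound_of_continuous
    ((φ.contDiff (n := 1)).continuous_fderiv one_ne_zero)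
  refine ⟨max 1 (B * ‖Λ‖), fun x => ⟨?_, ?_⟩⟩
  · rw [Real.norm_of_nonneg φ.nonneg]
    exact φ.le_one.trans (le_max_left _ _)
  · have h1 : HasFDerivAt (fun x => φ (Λ x)) ((fderiv ℝ φ (Λ x)).comp Λ) x :=
      (((φ.contDiff (n := 1)).differentiable one_ne_zero) (Λ x)).hasFDerivAt.comp x Λ.hasFDerivAt
    rw [h1.fderiv]
    exact (ContinuousLinearMap.opNorm_comp_le _ _).trans
      ((mul_le_mul_of_nonneg_right (hB _) (norm_nonneg _)).trans (le_max_right _ _))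

theorem IsC1Bounded.eventually_c1Norm_lt {p : E → E} (hp : IsC1Bounded p)
    (dp : Differentiable ℝ p) {δ : ℝ} (hδ : 0 < δ) :
    ∀ᶠ ε in 𝓝 (0 : ℝ), c1Norm (ε • p) < ENNReal.ofReal δ := by
  obtain ⟨B, hB⟩ := hp
  have hc : ∀ᶠ ε in 𝓝 (0 : ℝ), ‖ε‖ * B < δ := by
    have : ContinuousAt (fun ε : ℝ => ‖ε‖ * B) 0 := by fun_prop
    exact this.eventually (gt_mem_nhds (by simpa using hδ))
  filter_upwards [hc] with ε hε
  refine lt_of_le_of_lt (iSup_le fun x => ?_) ((ENNReal.ofReal_lt_ofReal_iff hδ).2 hε)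
  refine max_le ?_ ?_
  · rw [← ofReal_norm, Pi.smul_apply, norm_smul]
    exact ENNReal.ofReal_le_ofReal (mul_le_mul_of_nonneg_left (hB x).1 (norm_nonneg _))
  · rw [← ofReal_norm, fderiv_const_smul (dp x), norm_smul]
    exact ENNReal.ofReal_le_ofReal (mul_le_mul_of_nonneg_left (hB x).2 (norm_nonneg _))

end C1Bounded

/-! ### Input isomorphisms, input states and admissible maps -/

namespace Network

variable {C A : Type*} {G : Network C A}

theorem StateEquiv.symm {c d : C} (h : G.StateEquiv c d) : G.StateEquiv d c :=
  Relation.EqvGen.symm _ _ h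

theorem StateEquiv.trans {c d e : C} (h : G.StateEquiv c d) (h' : G.StateEquiv d e) :
    G.StateEquiv c e := Relation.EqvGen.trans _ _ _ h h'

namespace InputIso

theorem toEquiv_injective {c d : C} :
    Function.Injective (InputIso.toEquiv : G.InputIso c d → G.Input c ≃ G.Input d) := by
  rintro ⟨β, _, _⟩ ⟨β', _, _⟩ h
  cases h
  rfl

instance [Finite A] {c d : C} : Finite (G.InputIso c d) :=
  Finite.of_injective _ toEquiv_injective

/-- The identity input isomorphism. -/
def refl (c : C) : G.InputIso c c where
  toEquiv := Equiv.refl _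
  nodeType_rel := G.nodeType.refl c
  arrowType_rel a := G.arrowType.refl a.1

/-- The inverse input isomorphism. -/
def symm {c d : C} (β : G.InputIso c d) : G.InputIso d c where
  toEquiv := β.toEquiv.symm
  nodeType_rel := G.nodeType.symm β.nodeType_rel
  arrowType_rel a := by
    have := β.arrowType_rel (β.toEquiv.symm a)
    rw [Equiv.apply_symm_apply] at this
    exact G.arrowType.symm this

/-- Composition of input isomorphisms. -/
def trans {c d e : C} (β : G.InputIso c d) (γ : G.InputIso d e) : G.InputIso c e where
  toEquiv := β.toEquiv.trans γ.toEquiv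
  nodeType_rel := G.nodeType.trans β.nodeType_rel γ.nodeType_rel
  arrowType_rel a := G.arrowType.trans (β.arrowType_rel a) (γ.arrowType_rel _)

/-- Composition with a fixed input isomorphism on the right. -/
def transEquiv (b : C) {c d : C} (γ : G.InputIso c d) : G.InputIso b c ≃ G.InputIso b d where
  toFun β := β.trans γ
  invFun β := β.trans γ.symm
  left_inv β := toEquiv_injective (by ext; simp [trans, symm])
  right_inv β := toEquiv_injective (by ext; simp [trans, symm])

end InputIso

namespace Colouring

/-- Two nodes of the same colour that are related by a colour-preserving input isomorphism. -/
def InputRel (K : G.Colouring) (c d : C) : Prop :=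
  K.rel c d ∧ ∃ β : G.InputIso c d, ∀ e : G.Input c, K.rel (G.tail e.1) (G.tail (β.toEquiv e).1)

variable {K : G.Colouring}

theorem InputRel.refl (c : C) : K.InputRel c c :=
  ⟨K.rel.refl c, .refl c, fun _ => K.rel.refl _⟩

theorem InputRel.symm {c d : C} (h : K.InputRel c d) : K.InputRel d c := by
  obtain ⟨h, β, hβ⟩ := h
  refine ⟨K.rel.symm h, β.symm, fun e => K.rel.symm ?_⟩
  have := hβ (β.toEquiv.symm e)
  rwa [Equiv.apply_symm_apply] at this

theorem InputRel.trans {c d e : C} (h : K.InputRel c d) (h' : K.InputRel d e) :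
    K.InputRel c e := by
  obtain ⟨h, β, hβ⟩ := h
  obtain ⟨h', β', hβ'⟩ := h'
  exact ⟨K.rel.trans h h', β.trans β', fun e => K.rel.trans (hβ e) (hβ' _)⟩

end Colouring

namespace NodeSpaces

variable (V : G.NodeSpaces)

@[simp] theorem transport_transport {c d e : C} (h : G.StateEquiv c d) (h' : G.StateEquiv d e)
    (v : V.Space c) : V.transport h' (V.transport h v) = V.transport (h.trans h') v := rfl

@[simp] theorem transport_symm {c d : C} (h : G.StateEquiv c d) (v : V.Space d) :
    (V.transport h).symm v = V.transport h.symm v := rfl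

variable {V}

theorem Synchronous.transport_eq {x : V.State} {c d : C} (h : V.Synchronous x c d)
    (h' : G.StateEquiv c d) : V.transport h' (x c) = x d := h.2

variable (V)

/-- The polydiagonal of a colouring, as a linear subspace. -/
def polydiagonalSubmodule (K : G.Colouring) : Submodule ℝ V.State where
  carrier := V.polydiagonal K
  zero_mem' c d h := ⟨K.stateEquiv _ _ h, by simp⟩
  add_mem' hx hy c d h := ⟨K.stateEquiv _ _ h, by
    rw [Pi.add_apply, map_add, (hx c d h).transport_eq, (hy c d h).transport_eq]; rfl⟩
  smul_mem' a x hx c d h := ⟨K.stateEquiv _ _ h, by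
    rw [Pi.smul_apply, map_smul, (hx c d h).transport_eq]; rfl⟩

/-- The states of a node and of the tail nodes of its input arrows. -/
abbrev InputState (c : C) : Type _ := V.Space c × ∀ e : G.Input c, V.Space (G.tail e.1)

/-- The state of the input set of `c`, as a function of the state of the network. -/
def inputState (c : C) : V.State →L[ℝ] V.InputState c :=
  (ContinuousLinearMap.proj c).prod
    (ContinuousLinearMap.pi fun e : G.Input c => ContinuousLinearMap.proj (G.tail e.1))

theorem inputState_apply (c : C) (x : V.State) :
    V.inputState c x = (x c, fun e : G.Input c => x (G.tail e.1)) := rfl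

/-- The pullback map on input states of an input isomorphism. -/
def pullback {c d : C} (β : G.InputIso c d) : V.InputState d →L[ℝ] V.InputState c :=
  ((V.transport (G.stateEquiv_of_inputIso β)).symm.toContinuousLinearEquiv.toContinuousLinearMap ∘L
    ContinuousLinearMap.fst ℝ _ _).prod
  (ContinuousLinearMap.pi fun e : G.Input c =>
    (V.transport (G.stateEquiv_tail β e)).symm.toContinuousLinearEquiv.toContinuousLinearMap ∘L
      ContinuousLinearMap.proj (β.toEquiv e) ∘L ContinuousLinearMap.snd ℝ _ _)

theorem pullback_apply {c d : C} (β : G.InputIso c d) (u : V.InputState d) :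
    V.pullback β u = ((V.transport (G.stateEquiv_of_inputIso β)).symm u.1,
      fun e => (V.transport (G.stateEquiv_tail β e)).symm (u.2 (β.toEquiv e))) := rfl

theorem pullback_inputState_eq_iff {c d : C} (β : G.InputIso c d) (x : V.State) :
    V.pullback β (V.inputState d x) = V.inputState c x ↔
      V.Synchronous x c d ∧ ∀ e : G.Input c,
        V.Synchronous x (G.tail e.1) (G.tail (β.toEquiv e).1) := by
  rw [pullback_apply, inputState_apply, inputState_apply, Prod.mk.injEq, funext_iff]
  refine and_congr ?_ (forall_congr' fun e => ?_)
  · rw [LinearIsometryEquiv.symm_apply_eq, eq_comm]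
    exact ⟨fun h => ⟨_, h⟩, fun h => h.2⟩
  · rw [LinearIsometryEquiv.symm_apply_eq, eq_comm]
    exact ⟨fun h => ⟨_, h⟩, fun h => h.2⟩

variable {V}

theorem IsAdmissible.apply_eq {f : V.State → V.State} (hf : V.IsAdmissible f) {x y : V.State}
    {c : C} (h : V.inputState c x = V.inputState c y) : f x c = f y c := by
  obtain ⟨F, hF, -⟩ := hf
  rw [inputState_apply, inputState_apply, Prod.mk.injEq] at h
  rw [hF, hF, h.1, h.2]

theorem IsAdmissible.synchronous {f : V.State → V.State} (hf : V.IsAdmissible f) {x : V.State}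
    {c d : C} (β : G.InputIso c d) (h : V.pullback β (V.inputState d x) = V.inputState c x) :
    V.Synchronous (f x) c d := by
  obtain ⟨F, hF, hF'⟩ := hf
  refine ⟨G.stateEquiv_of_inputIso β, ?_⟩
  rw [hF x d, hF' c d β, hF x c]
  rw [pullback_apply, inputState_apply, inputState_apply, Prod.mk.injEq] at h
  rw [h.1, h.2]

theorem IsAdmissible.add {f g : V.State → V.State} (hf : V.IsAdmissible f)
    (hg : V.IsAdmissible g) : V.IsAdmissible (f + g) := by
  obtain ⟨F, hF, hF'⟩ := hf
  obtain ⟨H, hH, hH'⟩ := hg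
  refine ⟨fun c v w => F c v w + H c v w, fun x c => ?_, fun c d β v w => ?_⟩
  · rw [Pi.add_apply, Pi.add_apply, hF, hH]
  · simp only [hF' c d β, hH' c d β, map_add]

theorem IsAdmissible.smul {f : V.State → V.State} (hf : V.IsAdmissible f) (a : ℝ) :
    V.IsAdmissible (a • f) := by
  obtain ⟨F, hF, hF'⟩ := hf
  refine ⟨fun c v w => a • F c v w, fun x c => ?_, fun c d β v w => ?_⟩
  · rw [Pi.smul_apply, Pi.smul_apply, hF]
  · simp only [hF' c d β, map_smul]

theorem isAdmissible_zero : V.IsAdmissible 0 :=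
  ⟨fun _ _ _ => 0, fun _ _ => rfl, fun _ _ _ _ _ => by simp⟩

variable (V) [Fintype C]

/-- The smooth admissible maps that are bounded together with their first derivative. -/
def perturbations : Submodule ℝ (V.State → V.State) where
  carrier := {p | V.IsAdmissible p ∧ ContDiff ℝ ∞ p ∧ IsC1Bounded p}
  zero_mem' := ⟨isAdmissible_zero, contDiff_const, isC1Bounded_const 0⟩
  add_mem' hp hq := ⟨hp.1.add hq.1, hp.2.1.add hq.2.1, hp.2.2.add hq.2.2
    (hp.2.1.differentiable (by simp)) (hq.2.1.differentiable (by simp))⟩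
  smul_mem' a _ hp := ⟨hp.1.smul a, hp.2.1.const_smul a,
    hp.2.2.const_smul (hp.2.1.differentiable (by simp)) a⟩

variable {V}

theorem eventually_isPerturbation [DecidableEq C] {p : V.State → V.State}
    (hp : p ∈ V.perturbations) {δ : ℝ} (hδ : 0 < δ) :
    ∀ᶠ ε in 𝓝 (0 : ℝ), V.IsPerturbation δ (ε • p) := by
  filter_upwards [hp.2.2.eventually_c1Norm_lt (hp.2.1.differentiable (by simp)) hδ] with ε hε
  exact ⟨hp.1.smul ε, hp.2.1.const_smul ε, hε⟩

variable [Finite A]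

variable (V) in
open Classical in
/-- The vector equal to `b`, up to transport, at the nodes whose input state in `x` is isomorphic
to the input state `u` of `q`, and to `0` at the other nodes. -/
def orbitIndicator (q : C) (u : V.InputState q) (b : V.Space q) (x : V.State) : V.State := fun i =>
  if h : ∃ β : G.InputIso q i, V.pullback β (V.inputState i x) = u then
    V.transport (G.stateEquiv_of_inputIso h.choose) b else 0

/-! ### Admissible bump perturbations -/

/-- Perturbations concentrated near the orbit of an input state under input isomorphisms. -/
theorem exists_bumps (q : C) (u : V.InputState q) (b : V.Space q) :
    ∃ p : ℕ → V.State → V.State, (∀ n, p n ∈ V.perturbations) ∧ (∀ n x, ‖p n x‖ ≤ ‖b‖) ∧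
      ∀ x, ∀ᶠ n in atTop, p n x = V.orbitIndicator q u b x := by
  classical
  let _ : Fintype A := Fintype.ofFinite A
  let _ : ∀ i, Fintype (G.InputIso q i) := fun i => Fintype.ofFinite _
  let φ : ℕ → ContDiffBump u := fun n => ⟨1 / (2 * ((n : ℝ) + 1)), 1 / ((n : ℝ) + 1), by positivity,
    one_div_lt_one_div_of_lt (by positivity) (by linarith [(Nat.cast_nonneg n : (0 : ℝ) ≤ n)])⟩
  -- Spreading `b` over the whole state class makes it compatible with every input isomorphism; the
  -- scalar weight `w` does the localization.
  let b' : V.State := fun i => if h : G.StateEquiv q i then V.transport h b else 0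
  have hb' : ∀ i j (γ : G.InputIso i j), V.transport (G.stateEquiv_of_inputIso γ) (b' i) = b' j :=
    fun i j γ => by
      have hγ := G.stateEquiv_of_inputIso γ
      by_cases h : G.StateEquiv q i
      · simp only [b', dif_pos h, dif_pos (h.trans hγ), transport_transport]
      · have h' : ¬ G.StateEquiv q j := fun h' => h (h'.trans hγ.symm)
        simp only [b', dif_neg h, dif_neg h', map_zero]
  have hb'n : ∀ i, ‖b' i‖ ≤ ‖b‖ := fun i => by
    simp only [b']
    split_ifs
    · simp
    · simp
  -- A smooth "or" over all `β`: it is 1 once a single bump is 1, and 0 when all bumps vanish.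
  -- Unlike a sum it stays in `[0, 1]`. Composition with an input isomorphism only permutes the
  -- factors, which gives admissibility.
  let w : ℕ → ∀ i, V.InputState i → ℝ := fun n i y =>
    1 - ∏ β : G.InputIso q i, (1 - φ n (V.pullback β y))
  have hw : ∀ n i j (γ : G.InputIso i j) y, w n j y = w n i (V.pullback γ y) := fun n i j γ y => by
    simp only [w]
    rw [← Equiv.prod_comp (InputIso.transEquiv q γ)]
    rfl
  have hw01 : ∀ n i y, ‖w n i y‖ ≤ 1 := fun n i y => by
    have h1 : 0 ≤ ∏ β : G.InputIso q i, (1 - φ n (V.pullback β y)) :=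
      Finset.prod_nonneg fun β _ => sub_nonneg.2 (φ n).le_one
    have h2 : ∏ β : G.InputIso q i, (1 - φ n (V.pullback β y)) ≤ 1 :=
      Finset.prod_le_one (fun β _ => sub_nonneg.2 (φ n).le_one)
        (fun β _ => sub_le_self _ (φ n).nonneg)
    rw [Real.norm_eq_abs, abs_le]
    constructor <;> simp only [w] <;> linarith
  let p : ℕ → V.State → V.State := fun n x i => w n i (V.inputState i x) • b' i
  have hsm : ∀ n i, ContDiff ℝ ∞ fun x : V.State => w n i (V.inputState i x) := fun n i => by
    refine contDiff_const.sub (contDiff_prod fun β _ => contDiff_const.sub ?_)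
    exact (φ n).contDiff.comp ((V.pullback β).contDiff.comp (V.inputState i).contDiff)
  have hbd : ∀ n i, IsC1Bounded fun x : V.State => w n i (V.inputState i x) := fun n i => by
    have hφ : ∀ β : G.InputIso q i, ContDiff ℝ ∞ fun x : V.State =>
        φ n (V.pullback β (V.inputState i x)) := fun β =>
      (φ n).contDiff.comp ((V.pullback β).contDiff.comp (V.inputState i).contDiff)
    have hsub : ∀ g : V.State → ℝ, ContDiff ℝ ∞ g → IsC1Bounded g →
        IsC1Bounded fun x => 1 - g x := fun g hg hgb => by
      have := (isC1Bounded_const (E := V.State) (1 : ℝ)).add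
        (hgb.const_smul (hg.differentiable (by simp)) (-1)) (differentiable_const _)
        ((hg.differentiable (by simp)).const_smul _)
      convert this using 2 with x
      simp [sub_eq_add_neg]
    refine hsub _ (contDiff_prod fun β _ => contDiff_const.sub (hφ β)) ?_
    refine IsC1Bounded.finset_prod _ (fun β => hsub _ (hφ β) ?_)
      (fun β => (contDiff_const.sub (hφ β)).differentiable (by simp))
    exact (φ n).isC1Bounded (V.pullback β ∘L V.inputState i)
  refine ⟨p, fun n => ⟨?_, ?_, ?_⟩, fun n x => ?_, fun x => ?_⟩
  · refine ⟨fun i v y => w n i (v, y) • b' i, fun x i => rfl, fun i j γ v y => ?_⟩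
    beta_reduce
    rw [hw n i j γ, map_smul, hb' i j γ]
    rfl
  · exact contDiff_pi.2 fun i => (hsm n i).smul contDiff_const
  · exact IsC1Bounded.pi (fun i => (hbd n i).smul_const ((hsm n i).differentiable (by simp)) _)
      (fun i => ((hsm n i).differentiable (by simp)).smul_const _)
  · refine (pi_norm_le_iff_of_nonneg (norm_nonneg _)).2 fun i => ?_
    rw [norm_smul]
    exact (mul_le_mul (hw01 _ _ _) (hb'n i) (norm_nonneg _) zero_le_one).trans (one_mul _).le
  · have hfar : ∀ i (β : G.InputIso q i), V.pullback β (V.inputState i x) ≠ u →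
        ∀ᶠ n in atTop, φ n (V.pullback β (V.inputState i x)) = 0 := fun i β hne => by
      have h0 : 0 < dist (V.pullback β (V.inputState i x)) u := dist_pos.2 hne
      filter_upwards [tendsto_one_div_add_atTop_nhds_zero_nat.eventually (gt_mem_nhds h0)] with n hn
      exact (φ n).zero_of_le_dist hn.le
    have hall : ∀ᶠ n in atTop, ∀ i (β : G.InputIso q i), V.pullback β (V.inputState i x) ≠ u →
        φ n (V.pullback β (V.inputState i x)) = 0 := by
      refine eventually_all.2 fun i => eventually_all.2 fun β => ?_
      by_cases h : V.pullback β (V.inputState i x) = u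
      · exact Eventually.of_forall fun n hn => absurd h hn
      · exact (hfar i β h).mono fun n hn _ => hn
    filter_upwards [hall] with n hn
    funext i
    simp only [orbitIndicator, p]
    split_ifs with h
    · obtain ⟨β, hβ⟩ := id h
      have hw1 : w n i (V.inputState i x) = 1 := by
        simp only [w]
        rw [Finset.prod_eq_zero (Finset.mem_univ β), sub_zero]
        rw [hβ, (φ n).one_of_mem_closedBall (Metric.mem_closedBall_self (φ n).rIn_pos.le), sub_self]
      rw [hw1, one_smul]
      simp only [b', dif_pos (G.stateEquiv_of_inputIso h.choose)]
    · have hw0 : w n i (V.inputState i x) = 0 := by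
        simp only [w]
        rw [Finset.prod_eq_one, sub_self]
        intro β _
        rw [hn i β (fun h' => h ⟨β, h'⟩), sub_zero]
      rw [hw0, zero_smul]

end NodeSpaces

end Network

/-! ### Null fibres and a dimension count -/

section Auxiliary

/-- A nonconstant curve meets points that lie on given curves only for a null set of times. -/
theorem exists_forall_measure_fiber_eq_zero {X ι : Type*} [MetricSpace X] [Countable ι]
    {g : ι → ℝ → X} (hg : ∀ i, Continuous (g i)) {u : ℝ → X} (hu : Continuous u) {a b : ℝ}
    (hne : ∃ s ∈ Ioo a b, ∃ s' ∈ Ioo a b, u s ≠ u s') :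
    ∃ s ∈ Ioo a b, ∀ i, volume {r | g i r = u s} = 0 := by
  by_contra! hcon
  -- Disjoint sets of positive measure are countably many, whereas a connected image in a countable
  -- set is a single point.
  have hcount : (⋃ i, {z | 0 < volume {r | g i r = z}}).Countable := by
    refine countable_iUnion fun i => Measure.countable_meas_pos_of_disjoint_iUnion
      (As := fun z => {r | g i r = z}) (fun z => ?_) (fun z z' hz => ?_)
    · exact (isClosed_singleton.preimage (hg i)).measurableSet
    · exact Disjoint.preimage (g i) (disjoint_singleton.mpr hz)
  have hsub : u '' Ioo a b ⊆ ⋃ i, {z | 0 < volume {r | g i r = z}} := by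
    rintro _ ⟨s, hs, rfl⟩
    obtain ⟨i, hi⟩ := hcon s hs
    exact mem_iUnion.2 ⟨i, pos_iff_ne_zero.2 hi⟩
  obtain ⟨s, hs, s', hs', h⟩ := hne
  exact h ((hcount.mono hsub).isTotallyDisconnected _ Subset.rfl
    (isPreconnected_Ioo.image u hu.continuousOn) (mem_image_of_mem u hs) (mem_image_of_mem u hs'))

variable {E : Type*} [NormedAddCommGroup E] [NormedSpace ℝ E] [FiniteDimensional ℝ E]

theorem HasDerivAt.mem_submodule {v : ℝ → E} {v' : E} {a b s : ℝ} (hv : HasDerivAt v v' s)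
    (hs : s ∈ Ioo a b) {W : Submodule ℝ E} (hW : ∀ r ∈ Ioo a b, v r ∈ W) : v' ∈ W := by
  refine W.closed_of_finiteDimensional.mem_of_tendsto (hasDerivAt_iff_tendsto_slope.1 hv) ?_
  filter_upwards [nhdsWithin_le_nhds (Ioo_mem_nhds hs.1 hs.2)] with r hr
  rw [slope_def_module]
  exact W.smul_mem _ (W.sub_mem (hW r hr) (hW s hs))

/-- Split `D = U ⊕ W`. Invariance of `U` gives `U + M D ≤ U + M W`, whose dimension is at most that
of `D`, so the inclusion of `D` is an equality. -/
theorem Submodule.sup_map_le_of_invariant {M : E →ₗ[ℝ] E} {U D : Submodule ℝ E} (hUD : U ≤ D)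
    (hMU : U.map M ≤ U) (hD : D ≤ U ⊔ D.map M) : U ⊔ D.map M ≤ D := by
  obtain ⟨W, hUW, hW⟩ : ∃ W : Submodule ℝ E, Disjoint U W ∧ U ⊔ W = D := by
    obtain ⟨W, h⟩ := exists_isCompl (Submodule.comap D.subtype U)
    refine ⟨W.map D.subtype, ?_, ?_⟩
    · rw [Submodule.disjoint_def]
      rintro _ hx ⟨w, hw, rfl⟩
      have := (Submodule.disjoint_def.1 h.disjoint) w hx hw
      simp [this]
    · have h2 := congrArg (Submodule.map D.subtype) h.sup_eq_top
      rwa [Submodule.map_sup, Submodule.map_comap_subtype, Submodule.map_top,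
        Submodule.range_subtype, inf_eq_right.2 hUD] at h2
  have h1 : U ⊔ D.map M ≤ U ⊔ W.map M := by
    rw [← hW, Submodule.map_sup]
    exact sup_le le_sup_left (sup_le (hMU.trans le_sup_left) le_sup_right)
  have h2 : Module.finrank ℝ ↥(U ⊔ W.map M) ≤ Module.finrank ℝ D := by
    have h3 := Submodule.finrank_add_le_finrank_add_finrank U (W.map M)
    have h4 := Submodule.finrank_map_le M W
    have h5 := Submodule.finrank_sup_add_finrank_inf_eq U W
    rw [hUW.eq_bot, finrank_bot, hW] at h5
    omega
  have h6 := Submodule.eq_of_le_of_finrank_le (hD.trans h1) h2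
  exact h1.trans h6.ge

end Auxiliary

/-! ### Local rigidity turned into a statement on linear responses -/

namespace Network

namespace NodeSpaces

variable {C A : Type*} {G : Network C A} {V : G.NodeSpaces} [Fintype C]

/-- `v` is a response, with frequency correction `ρ`, of the orbit piece `γ` of `f` to the
perturbation `p`, and respects the colouring `K`. -/
structure IsResponse (K : G.Colouring) (f : V.State → V.State) (γ : ℝ → V.State) (T s₀ B : ℝ)
    (p : V.State → V.State) (v : ℝ → V.State) (ρ : ℝ) : Prop where
  mem : ∀ s ∈ Ioo 0 s₀, v s ∈ V.polydiagonalSubmodule K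
  hasDerivAt : ∀ s ∈ Ioo 0 s₀,
    HasDerivAt v (T • (fderiv ℝ f (γ s) (v s) + p (γ s)) + ρ • f (γ s)) s
  norm_le : ∀ s ∈ Ioo 0 s₀, ‖v s‖ ≤ B * ∫ r in (0 : ℝ)..1, ‖p (γ r)‖
  abs_le : |ρ| ≤ B * ∫ r in (0 : ℝ)..1, ‖p (γ r)‖

/-- Rigidity is applied to `ε p` for small `ε > 0`; the derivative at `ε = 0` inherits the
synchrony. The constant `B` does not depend on `p`, so it serves for whole sequences of bumps. -/
theorem IsLocallyRigidSynchronyPattern.exists_responses [DecidableEq C] {K : G.Colouring}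
    {f : V.State → V.State} (hf : ContDiff ℝ ∞ f) {x : ℝ → V.State} {T t₀ : ℝ}
    (hx : IsHyperbolicPeriodicOrbit f x T) (hK : V.IsLocallyRigidSynchronyPattern K f x T t₀) :
    ∃ s₀, 0 < s₀ ∧
      (∀ s ∈ Ico 0 s₀, ∀ c d, V.Synchronous (x (t₀ + T * s)) c d ↔ K.rel c d) ∧
      ∃ B, ∀ p ∈ V.perturbations, ∃ v ρ,
        IsResponse K f (fun s => x (t₀ + T * s)) T s₀ B p v ρ := by
  obtain ⟨ℓ, hℓ, η, hη, ε, hε, t', ht', H⟩ := hK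
  have hf1 : ContDiff ℝ 1 f := hf.of_le (by simp)
  have hT := hx.1.pos
  have hxc := hx.1.continuous
  have hpat : ∀ t, |t - t₀| < t' → ∀ c d, V.Synchronous (x t) c d ↔ K.rel c d := by
    -- The unperturbed orbit is its own nearby orbit for `p = 0`.
    refine (H 0 ⟨isAdmissible_zero, contDiff_const, ?_⟩ x T ⟨?_, ?_, ?_⟩ rfl).2
    · have : c1Norm (0 : V.State → V.State) = 0 := by simp [c1Norm]
      rw [this]
      simpa using hε
    · rw [add_zero]; exact hx.1
    · simpa using hη
    · intro t _; simpa using hη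
  obtain ⟨S, hS, hSW⟩ := hx.exists_linearResponse hf1 hℓ
  set γ := orbitCurve x hxc T t₀ with hγ
  have hlt : ∀ s < min 1 (t' / (2 * T)), 2 * T * s < t' := fun s hs => by
    have := (lt_div_iff₀ (by positivity)).1 (hs.trans_le (min_le_right _ _))
    linarith
  refine ⟨min 1 (t' / (2 * T)), lt_min one_pos (by positivity),
    fun s hs => hpat _ ?_, ‖S‖ * T, fun p hp => ?_⟩
  · have h1 : 0 ≤ T * s := mul_nonneg hT.le hs.1
    rw [add_sub_cancel_left, abs_of_nonneg h1]
    linarith [hlt s hs.2]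
  have hp1 : ContDiff ℝ 1 p := hp.2.1.of_le (by simp)
  set h : C(I, V.State) := T • primitive (superposition p hp1.continuous γ) with hh
  rcases hvρ : S h with ⟨v, ρ⟩
  have hbound : ‖S h‖ ≤ ‖S‖ * T * ∫ r in (0 : ℝ)..1, ‖p (x (t₀ + T * r))‖ := by
    refine (S.le_opNorm h).trans ?_
    rw [mul_assoc]
    refine mul_le_mul_of_nonneg_left ?_ (norm_nonneg _)
    rw [hh, norm_smul, Real.norm_of_nonneg hT.le]
    refine mul_le_mul_of_nonneg_left ((norm_primitive_le _).trans (le_of_eq ?_)) hT.le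
    refine intervalIntegral.integral_congr fun r hr => ?_
    rw [uIcc_of_le zero_le_one] at hr
    rw [extendCurve_of_mem _ hr]
    rfl
  have hsub : ∀ s ∈ Ioo 0 (min 1 (t' / (2 * T))), s ∈ Ioo (0 : ℝ) 1 := fun s hs =>
    ⟨hs.1, hs.2.trans_le (min_le_left _ _)⟩
  have hI : ∀ s ∈ Ioo (0 : ℝ) 1, s ∈ Icc (0 : ℝ) 1 := fun s hs => Ioo_subset_Icc_self hs
  refine ⟨extendCurve v, ρ, fun s hs => ?_, fun s hs => ?_, fun s _ => ?_, ?_⟩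
  · have key := hSW p hp1 (V.polydiagonalSubmodule K) t' ht' η hη
      (fun t ht c d hcd => (hpat t ht c d).2 hcd) ?_ ⟨s, hI s (hsub s hs)⟩ (hlt s hs.2)
    · rw [← hh, hvρ] at key
      rwa [extendCurve_of_mem _ (hI s (hsub s hs))]
    · filter_upwards [nhdsWithin_le_nhds (eventually_isPerturbation hp hε)] with δ hδ y T' hy hℓy
      exact fun t ht c d hcd => ((H _ hδ y T' hy hℓy).2 t ht c d).2 hcd
  · have heq := hS h
    rw [hvρ, linearization_apply, Prod.mk.injEq] at heq
    set k : C(I, V.State) := pointwiseApply (variationalCurve hf1 x hxc T t₀) v +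
      ρ • superposition f hf1.continuous γ + T • superposition p hp1.continuous γ with hk
    have hv : v = constCurve (v 1) + primitive k := by
      rw [hk, map_add, map_smul, ← hh, ← heq.1]
      abel
    have hd : HasDerivAt (fun r : ℝ => v 1 + ∫ r in (0 : ℝ)..r, extendCurve k r)
        (extendCurve k s) s := (hasDerivAt_integral_extendCurve k s).const_add _
    have hev : extendCurve v =ᶠ[𝓝 s] fun r : ℝ => v 1 + ∫ r in (0 : ℝ)..r, extendCurve k r := by
      filter_upwards [Ioo_mem_nhds (hsub s hs).1 (hsub s hs).2] with r hr
      rw [extendCurve_of_mem _ (hI r hr)]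
      exact DFunLike.congr_fun hv _
    refine (hd.congr_of_eventuallyEq hev).congr_deriv ?_
    rw [extendCurve_of_mem _ (hI s (hsub s hs)), extendCurve_of_mem _ (hI s (hsub s hs)), hk]
    simp only [ContinuousMap.add_apply, pointwiseApply_apply, ContinuousMap.smul_apply,
      superposition_apply, hγ, orbitCurve_apply, smul_add]
    have : (variationalCurve hf1 x hxc T t₀) ⟨s, hI s (hsub s hs)⟩ =
      T • fderiv ℝ f (x (t₀ + T * s)) := rfl
    rw [this, smul_apply]
    abel
  · refine le_trans ?_ hbound
    rw [hvρ]
    exact (norm_extendCurve_le v s).trans (le_max_left _ _)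
  · refine le_trans ?_ hbound
    rw [hvρ]
    exact le_max_right _ _

end NodeSpaces

end Network

/-! ### Responses that respect a colouring force it to be balanced -/

namespace Network

namespace NodeSpaces

variable {C A : Type*} {G : Network C A} {V : G.NodeSpaces}

variable (V) in
open Classical in
/-- The projection of the state space onto the components in a set of nodes. -/
def nodeProjection (P : C → Prop) : V.State →L[ℝ] V.State :=
  ContinuousLinearMap.pi fun i => if P i then ContinuousLinearMap.proj i else 0

open Classical in
theorem nodeProjection_apply (P : C → Prop) (w : V.State) (i : C) :
    V.nodeProjection P w i = if P i then w i else 0 := by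
  simp only [nodeProjection, ContinuousLinearMap.pi_apply]
  split_ifs <;> rfl

theorem nodeProjection_of_pos {P : C → Prop} (w : V.State) {i : C} (h : P i) :
    V.nodeProjection P w i = w i := by
  rw [nodeProjection_apply, if_pos h]

theorem nodeProjection_of_neg {P : C → Prop} (w : V.State) {i : C} (h : ¬ P i) :
    V.nodeProjection P w i = 0 := by
  rw [nodeProjection_apply, if_neg h]

theorem nodeProjection_add_not (P : C → Prop) (w : V.State) :
    V.nodeProjection P w + V.nodeProjection (fun i => ¬ P i) w = w := by
  funext i
  by_cases h : P i
  · simp [nodeProjection_apply, h]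
  · simp [nodeProjection_apply, h]

/-- `P` is a union of classes of `InputRel`. A sum over all nodes `q` in `P` counts each class as
often as it has members, hence the weights `(n q)⁻¹`. -/
theorem sum_inputRel_projection_mem [Fintype C] (K : G.Colouring) {P : C → Prop}
    (hP : ∀ q i, K.InputRel q i → (P q ↔ P i)) (d : V.State) (W : Submodule ℝ V.State)
    (hW : ∀ q, P q → V.nodeProjection (K.InputRel q) d ∈ W) : V.nodeProjection P d ∈ W := by
  classical
  let n : C → ℝ := fun q => ((Finset.univ.filter (K.InputRel q)).card : ℝ)
  have hn : ∀ q i, K.InputRel q i → n q = n i := fun q i h => by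
    simp only [n]
    congr 2
    ext j
    simp only [Finset.mem_filter, Finset.mem_univ, true_and]
    exact ⟨fun h' => h.symm.trans h', fun h' => h.trans h'⟩
  have key : V.nodeProjection P d =
      ∑ q, (if P q then (n q)⁻¹ else 0) • V.nodeProjection (K.InputRel q) d := by
    funext i
    rw [Finset.sum_apply]
    by_cases hi : P i
    · have hn0 : n i ≠ 0 := by
        simp only [n, ne_eq, Nat.cast_eq_zero, Finset.card_eq_zero]
        exact Finset.ne_empty_of_mem (a := i) (by simp [Colouring.InputRel.refl])
      have h1 : ∀ q, ((if P q then (n q)⁻¹ else 0) • V.nodeProjection (K.InputRel q) d) i =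
          if K.InputRel i q then (n i)⁻¹ • d i else 0 := fun q => by
        rw [Pi.smul_apply]
        by_cases h : K.InputRel q i
        · rw [nodeProjection_of_pos _ h, if_pos h.symm, if_pos ((hP q i h).2 hi), hn q i h]
        · rw [nodeProjection_of_neg _ h, smul_zero, if_neg fun h' => h h'.symm]
      rw [Finset.sum_congr rfl fun q _ => h1 q, ← Finset.sum_filter, Finset.sum_const,
        nodeProjection_of_pos _ hi, ← Nat.cast_smul_eq_nsmul ℝ, smul_smul, mul_inv_cancel₀ hn0,
        one_smul]
    · rw [nodeProjection_of_neg _ hi, Finset.sum_eq_zero fun q _ => ?_]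
      rw [Pi.smul_apply]
      by_cases h : K.InputRel q i
      · rw [if_neg fun h' => hi ((hP q i h).1 h'), zero_smul]
      · rw [nodeProjection_of_neg _ h, smul_zero]
  rw [key]
  refine W.sum_mem fun q _ => ?_
  by_cases h : P q
  · exact W.smul_mem _ (hW q h)
  · rw [if_neg h, zero_smul]
    exact W.zero_mem

/-- As `z` has exactly the synchrony pattern `K`, an input isomorphism from `q` matches input states
iff it preserves colours and its end nodes share a colour. So a bump at `z` acts on exactly the
input class of `q`. -/
theorem orbitIndicator_eq {K : G.Colouring} {z d : V.State}
    (hz : ∀ i j, V.Synchronous z i j ↔ K.rel i j) (hd : d ∈ V.polydiagonalSubmodule K) (q : C) :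
    V.orbitIndicator q (V.inputState q z) (d q) z = V.nodeProjection (K.InputRel q) d := by
  funext i
  have hiff : (∃ β : G.InputIso q i, V.pullback β (V.inputState i z) = V.inputState q z) ↔
      K.InputRel q i := by
    simp only [pullback_inputState_eq_iff, hz, exists_and_left]
    rfl
  by_cases h : K.InputRel q i
  · rw [nodeProjection_of_pos _ h, orbitIndicator, dif_pos (hiff.2 h)]
    exact (hd q i h.1).transport_eq _
  · rw [nodeProjection_of_neg _ h, orbitIndicator, dif_neg fun h' => h (hiff.1 h')]

variable [Fintype C] [Finite A] {K : G.Colouring} {f : V.State → V.State} {γ : ℝ → V.State}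
  {T s₀ B : ℝ}

/-- Kicks: if the input state of `q` is not constant, then perturbations can act on the nodes
related to `q` at a single time, without any other response. -/
theorem apply_nodeProjection_mem (hT : 0 < T) (hγc : Continuous γ)
    (hpat : ∀ s ∈ Ioo 0 s₀, ∀ c d, V.Synchronous (γ s) c d ↔ K.rel c d)
    (hresp : ∀ p ∈ V.perturbations, ∃ v ρ, IsResponse K f γ T s₀ B p v ρ)
    {N : V.State →L[ℝ] V.State}
    (hN : ∀ p ∈ V.perturbations, ∀ v ρ, IsResponse K f γ T s₀ B p v ρ → ∀ s ∈ Ioo 0 s₀,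
      N (deriv v s) ∈ V.polydiagonalSubmodule K)
    {q : C} (hq : ∃ s ∈ Ioo 0 s₀, ∃ s' ∈ Ioo 0 s₀,
      V.inputState q (γ s) ≠ V.inputState q (γ s'))
    {d : V.State} (hd : d ∈ V.polydiagonalSubmodule K) :
    N (V.nodeProjection (K.InputRel q) d) ∈ V.polydiagonalSubmodule K := by
  classical
  let _ : Fintype A := Fintype.ofFinite A
  obtain ⟨s, hs, hnull⟩ := exists_forall_measure_fiber_eq_zero
    (X := V.InputState q) (ι := Σ i, G.InputIso q i)
    (g := fun j r => V.pullback j.2 (V.inputState j.1 (γ r))) (fun j =>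
      (V.pullback j.2).continuous.comp ((V.inputState j.1).continuous.comp hγc))
    (u := fun r => V.inputState q (γ r)) ((V.inputState q).continuous.comp hγc) hq
  obtain ⟨p, hp, hpn, hpe⟩ := exists_bumps q (V.inputState q (γ s)) (d q)
  choose v ρ hvρ using fun n => hresp (p n) (hp n)
  have hpc : ∀ n, Continuous fun r => p n (γ r) := fun n => (hp n).2.1.continuous.comp hγc
  -- By the choice of `s` the bumps die out at almost every time, and their height is bounded by
  -- that of `d q`.
  have hint : Tendsto (fun n => ∫ r in (0 : ℝ)..1, ‖p n (γ r)‖) atTop (𝓝 0) := by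
    have h0 : ∀ᵐ r : ℝ, V.orbitIndicator q (V.inputState q (γ s)) (d q) (γ r) = 0 := by
      have hall : ∀ᵐ r : ℝ, ∀ j : Σ i, G.InputIso q i,
          V.pullback j.2 (V.inputState j.1 (γ r)) ≠ V.inputState q (γ s) := by
        refine ae_all_iff.2 fun j => ?_
        rw [ae_iff]
        simpa using hnull j
      filter_upwards [hall] with r hr
      funext i
      rw [orbitIndicator, dif_neg]
      · rfl
      · rintro ⟨β, hβ⟩
        exact hr ⟨i, β⟩ hβ
    have := intervalIntegral.tendsto_integral_filter_of_dominated_convergence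
      (μ := volume) (a := (0 : ℝ)) (b := 1) (F := fun n r => ‖p n (γ r)‖) (f := fun _ => (0 : ℝ))
      (l := atTop) (fun _ => ‖d q‖)
      (Eventually.of_forall fun n => (hpc n).norm.aestronglyMeasurable)
      (Eventually.of_forall fun n => Eventually.of_forall fun r _ => by
        simpa using hpn n (γ r))
      intervalIntegrable_const (by
        filter_upwards [h0] with r hr _
        refine tendsto_const_nhds.congr' ?_
        filter_upwards [hpe (γ r)] with n hn
        rw [hn, hr, norm_zero])
    simpa using this
  have hint' : Tendsto (fun n => B * ∫ r in (0 : ℝ)..1, ‖p n (γ r)‖) atTop (𝓝 0) := by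
    simpa using hint.const_mul B
  have hv0 : Tendsto (fun n => v n s) atTop (𝓝 0) :=
    squeeze_zero_norm (fun n => (hvρ n).norm_le s hs) hint'
  have hρ0 : Tendsto ρ atTop (𝓝 0) := squeeze_zero_norm (fun n => (hvρ n).abs_le) hint'
  have hp0 : Tendsto (fun n => p n (γ s)) atTop (𝓝 (V.nodeProjection (K.InputRel q) d)) := by
    refine tendsto_const_nhds.congr' ?_
    filter_upwards [hpe (γ s)] with n hn
    rw [hn, orbitIndicator_eq (hpat s hs) hd]
  -- In the response equation only the forcing `T p(γ(s))` survives, as `v n s` and `ρ n` tend to 0.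
  have hlim : Tendsto (fun n => N (deriv (v n) s)) atTop
      (𝓝 (T • N (V.nodeProjection (K.InputRel q) d))) := by
    have h2 : Tendsto (fun n => deriv (v n) s) atTop
        (𝓝 (T • V.nodeProjection (K.InputRel q) d)) := by
      have h3 := ((((fderiv ℝ f (γ s)).continuous.tendsto 0).comp hv0).add hp0).const_smul T |>.add
        (hρ0.smul_const (f (γ s)))
      simp only [map_zero, zero_add, zero_smul, add_zero] at h3
      refine h3.congr fun n => ?_
      rw [((hvρ n).hasDerivAt s hs).deriv]
      rfl
    rw [← map_smul]
    exact (N.continuous.tendsto _).comp h2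
  have hmem := (V.polydiagonalSubmodule K).closed_of_finiteDimensional.mem_of_tendsto hlim
    (Eventually.of_forall fun n => hN _ (hp n) _ _ (hvρ n) s hs)
  have := (V.polydiagonalSubmodule K).smul_mem T⁻¹ hmem
  rwa [smul_smul, inv_mul_cancel₀ hT.ne', one_smul] at this

omit [Finite A] in
-- Translation by `z' - z` does not change the input states of the nodes in `P`, so the
-- `P`-components of `f` are invariant under it, and so is their derivative.
theorem IsAdmissible.nodeProjection_fderiv (hf : V.IsAdmissible f) (hfd : Differentiable ℝ f)
    {P : C → Prop} {z z' : V.State} (h : ∀ i, P i → V.inputState i z = V.inputState i z')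
    (w : V.State) :
    V.nodeProjection P (fderiv ℝ f z w) = V.nodeProjection P (fderiv ℝ f z' w) := by
  have hcomp : ∀ y, HasFDerivAt (fun y => V.nodeProjection P (f y))
      (V.nodeProjection P ∘L fderiv ℝ f y) y := fun y =>
    (V.nodeProjection P).hasFDerivAt.comp y (hfd y).hasFDerivAt
  have heq : (fun y => V.nodeProjection P (f y)) =
      fun y => V.nodeProjection P (f (y + (z' - z))) := by
    funext y i
    by_cases hi : P i
    · rw [nodeProjection_of_pos _ hi, nodeProjection_of_pos _ hi]
      refine hf.apply_eq ?_
      rw [map_add, map_sub, h i hi, sub_self, add_zero]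
    · rw [nodeProjection_of_neg _ hi, nodeProjection_of_neg _ hi]
  have h2 : HasFDerivAt (fun y => V.nodeProjection P (f (y + (z' - z))))
      (V.nodeProjection P ∘L fderiv ℝ f z') z := by
    rw [hasFDerivAt_comp_add_right (f := fun y => V.nodeProjection P (f y)) (z' - z)]
    rw [add_sub_cancel]
    exact hcomp z'
  rw [← heq] at h2
  exact DFunLike.congr_fun ((hcomp z).unique h2) w

/-- If every perturbation has a response that respects the colouring `K`, then `K` is balanced. -/
theorem isBalanced_of_responses (hf : V.IsAdmissible f) (hfd : Differentiable ℝ f) (hT : 0 < T)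
    (hγ : ∀ s, HasDerivAt γ (T • f (γ s)) s) (h0 : 0 < s₀)
    (hpat : ∀ s ∈ Ioo 0 s₀, ∀ c d, V.Synchronous (γ s) c d ↔ K.rel c d)
    (hresp : ∀ p ∈ V.perturbations, ∃ v ρ, IsResponse K f γ T s₀ B p v ρ) : K.IsBalanced := by
  have hγc : Continuous γ := continuous_iff_continuousAt.2 fun s => (hγ s).continuousAt
  set Δ := V.polydiagonalSubmodule K with hΔ
  set s₁ : ℝ := s₀ / 2 with hs₁
  have hs₁m : s₁ ∈ Ioo 0 s₀ := ⟨by positivity, by rw [hs₁]; linarith⟩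
  -- the nodes whose input state is constant
  set P : C → Prop := fun i => ∀ s ∈ Ioo 0 s₀, V.inputState i (γ s) = V.inputState i (γ s₁)
    with hPdef
  have hnP : ∀ q, ¬ P q → ∃ s ∈ Ioo 0 s₀, ∃ s' ∈ Ioo 0 s₀,
      V.inputState q (γ s) ≠ V.inputState q (γ s') := fun q hq => by
    simp only [hPdef] at hq
    push Not at hq
    obtain ⟨s, hs, h⟩ := hq
    exact ⟨s, hs, s₁, hs₁m, h⟩
  have hPrel' : ∀ q i, K.InputRel q i → P i → P q := fun q i h hi s hs => by
    obtain ⟨hqi, β, hβ⟩ := h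
    have h2 : ∀ s ∈ Ioo 0 s₀, V.pullback β (V.inputState i (γ s)) = V.inputState q (γ s) :=
      fun s hs => (V.pullback_inputState_eq_iff β _).2
        ⟨(hpat s hs _ _).2 hqi, fun e => (hpat s hs _ _).2 (hβ e)⟩
    rw [← h2 s hs, ← h2 s₁ hs₁m, hi s hs]
  have hPrel : ∀ q i, K.InputRel q i → (P q ↔ P i) := fun q i h =>
    ⟨hPrel' i q h.symm, hPrel' q i h⟩
  set π := V.nodeProjection P with hπ
  set π' := V.nodeProjection (fun i => ¬ P i) with hπ'
  have hsplit : ∀ w, π w + π' w = w := nodeProjection_add_not P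
  -- The input state contains the state of the node itself, so a node in `P` is at rest.
  have hπf : ∀ s ∈ Ioo 0 s₀, π (f (γ s)) = 0 := fun s hs => by
    funext i
    by_cases hi : P i
    · have h2 : HasDerivAt (fun r => γ r i) ((T • f (γ s)) i) s := (hasDerivAt_pi.1 (hγ s)) i
      have h3 : (fun r => γ r i) =ᶠ[𝓝 s] fun _ => γ s₁ i := by
        filter_upwards [Ioo_mem_nhds hs.1 hs.2] with r hr
        exact congrArg Prod.fst (hi r hr)
      have h4 : HasDerivAt (fun r => γ r i) 0 s :=
        (hasDerivAt_const s (γ s₁ i)).congr_of_eventuallyEq h3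
      have h5 := h2.unique h4
      rw [Pi.smul_apply, smul_eq_zero] at h5
      rw [hπ, nodeProjection_of_pos _ hi]
      exact h5.resolve_left hT.ne'
    · rw [hπ, nodeProjection_of_neg _ hi]; rfl
  set M : V.State →L[ℝ] V.State := T • (π ∘L fderiv ℝ f (γ s₁)) with hM
  have hπD : ∀ s ∈ Ioo 0 s₀, ∀ w, π (fderiv ℝ f (γ s) w) = π (fderiv ℝ f (γ s₁) w) :=
    fun s hs w => hf.nodeProjection_fderiv hfd (fun i hi => hi s hs) w
  have hπp : ∀ p ∈ V.perturbations, ∀ s ∈ Ioo 0 s₀, π (p (γ s)) = π (p (γ s₁)) :=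
    fun p hp s hs => by
      funext i
      by_cases hi : P i
      · rw [hπ, nodeProjection_of_pos _ hi, nodeProjection_of_pos _ hi]
        exact hp.1.apply_eq (hi s hs)
      · rw [hπ, nodeProjection_of_neg _ hi, nodeProjection_of_neg _ hi]
  have hπv : ∀ p ∈ V.perturbations, ∀ v ρ, IsResponse K f γ T s₀ B p v ρ → ∀ s ∈ Ioo 0 s₀,
      π (deriv v s) = M (v s) + T • π (p (γ s₁)) := fun p hp v ρ h s hs => by
    rw [(h.hasDerivAt s hs).deriv, map_add, map_smul, map_smul, map_add, hπf s hs, hπD s hs,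
      hπp p hp s hs, smul_zero, add_zero, smul_add]
    rfl
  -- derivatives of responses stay in the polydiagonal under iteration of `M`
  have claim : ∀ k : ℕ, (∀ p ∈ V.perturbations, ∀ v ρ, IsResponse K f γ T s₀ B p v ρ →
      ∀ s ∈ Ioo 0 s₀, (M ^ k) (deriv v s) ∈ Δ) ∧ ∀ d ∈ Δ, (M ^ k) (π' d) ∈ Δ := by
    intro k
    have hkick : ∀ k : ℕ, (∀ p ∈ V.perturbations, ∀ v ρ, IsResponse K f γ T s₀ B p v ρ →
        ∀ s ∈ Ioo 0 s₀, (M ^ k) (deriv v s) ∈ Δ) → ∀ d ∈ Δ, (M ^ k) (π' d) ∈ Δ :=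
      fun k hk d hd => sum_inputRel_projection_mem K (P := fun i => ¬ P i)
        (fun q i h => not_congr (hPrel q i h)) d (Δ.comap ((M ^ k : V.State →L[ℝ] V.State) :
          V.State →ₗ[ℝ] V.State)) fun q hq =>
        apply_nodeProjection_mem hT hγc hpat hresp hk (hnP q hq) hd
    have hderiv : ∀ p ∈ V.perturbations, ∀ v ρ, IsResponse K f γ T s₀ B p v ρ →
        ∀ s ∈ Ioo 0 s₀, deriv v s ∈ Δ := fun p hp v ρ h s hs => by
      rw [(h.hasDerivAt s hs).deriv]
      exact (h.hasDerivAt s hs).mem_submodule hs h.mem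
    induction k with
    | zero => exact ⟨hderiv, hkick 0 hderiv⟩
    | succ k ih =>
      suffices h : ∀ p ∈ V.perturbations, ∀ v ρ, IsResponse K f γ T s₀ B p v ρ →
          ∀ s ∈ Ioo 0 s₀, (M ^ (k + 1)) (deriv v s) ∈ Δ from ⟨h, hkick _ h⟩
      intro p hp v ρ h s hs
      -- The argument of `M ^ k` is `π v' = v' - π' v'`, and the induction hypothesis covers both
      -- terms. Differentiating in `r` removes the constant and gains one power of `M`.
      have h2 : ∀ r ∈ Ioo 0 s₀, (M ^ k) (M (v r) + T • π (p (γ s₁))) ∈ Δ := fun r hr => by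
        rw [← hπv p hp v ρ h r hr, eq_sub_of_add_eq (hsplit (deriv v r)), map_sub]
        exact Δ.sub_mem (ih.1 p hp v ρ h r hr) (ih.2 _ (hderiv p hp v ρ h r hr))
      have h3 : HasDerivAt (fun r => (M ^ k) (M (v r) + T • π (p (γ s₁))))
          ((M ^ k) (M (deriv v s))) s := by
        have h4 := (h.hasDerivAt s hs).differentiableAt.hasDerivAt
        exact (M ^ k).hasFDerivAt.comp_hasDerivAt s
          ((M.hasFDerivAt.comp_hasDerivAt s h4).add_const _)
      have := h3.mem_submodule hs h2
      rwa [pow_succ]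
  -- The largest `M`-invariant subspace of `Δ`.
  set U : Submodule ℝ V.State := ⨅ k : ℕ, Δ.comap ((M ^ k : V.State →L[ℝ] V.State) :
    V.State →ₗ[ℝ] V.State) with hU
  have hmemU : ∀ w, w ∈ U ↔ ∀ k : ℕ, (M ^ k) w ∈ Δ := fun w => by
    rw [hU, Submodule.mem_iInf]; rfl
  have hUΔ : U ≤ Δ := fun w hw => (hmemU w).1 hw 0
  have hMU : U.map (M : V.State →ₗ[ℝ] V.State) ≤ U := by
    rintro _ ⟨w, hw, rfl⟩
    refine (hmemU _).2 fun k => ?_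
    have := (hmemU w).1 hw (k + 1)
    rwa [pow_succ] at this
  have hπ'U : ∀ d ∈ Δ, π' d ∈ U := fun d hd => (hmemU _).2 fun k => (claim k).2 d hd
  -- Read `π v' = M v + T π p` backwards: `π v' ∈ U` by the claim, and `v ∈ Δ`.
  have hpert : ∀ p ∈ V.perturbations, T • π (p (γ s₁)) ∈ U ⊔ Δ.map (M : V.State →ₗ[ℝ] V.State) :=
    fun p hp => by
      obtain ⟨v, ρ, h⟩ := hresp p hp
      have h2 : π (deriv v s₁) ∈ U := by
        refine (hmemU _).2 fun k => ?_
        have hd := (claim 0).1 p hp v ρ h s₁ hs₁m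
        rw [eq_sub_of_add_eq (hsplit (deriv v s₁)), map_sub]
        exact Δ.sub_mem ((claim k).1 p hp v ρ h s₁ hs₁m) ((claim k).2 _ hd)
      rw [hπv p hp v ρ h s₁ hs₁m] at h2
      have h3 : M (v s₁) ∈ Δ.map (M : V.State →ₗ[ℝ] V.State) := ⟨v s₁, h.mem s₁ hs₁m, rfl⟩
      have h4 := Submodule.sub_mem _ (Submodule.mem_sup_left h2) (Submodule.mem_sup_right (S := U) h3)
      rwa [add_sub_cancel_left] at h4
  have hbump : ∀ q, P q → ∀ d ∈ Δ,
      V.nodeProjection (K.InputRel q) d ∈ U ⊔ Δ.map (M : V.State →ₗ[ℝ] V.State) :=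
    fun q hq d hd => by
      obtain ⟨p, hp, -, hpe⟩ := exists_bumps q (V.inputState q (γ s₁)) (d q)
      obtain ⟨n, hn⟩ := (hpe (γ s₁)).exists
      rw [orbitIndicator_eq (hpat s₁ hs₁m) hd] at hn
      have h2 : π (p n (γ s₁)) = V.nodeProjection (K.InputRel q) d := by
        rw [hn]
        funext i
        by_cases hi : P i
        · rw [hπ, nodeProjection_of_pos _ hi]
        · rw [hπ, nodeProjection_of_neg _ hi,
            nodeProjection_of_neg _ fun h => hi ((hPrel q i h).1 hq)]
      have h3 := Submodule.smul_mem _ T⁻¹ (hpert _ (hp n))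
      rwa [h2, smul_smul, inv_mul_cancel₀ hT.ne', one_smul] at h3
  have hle : U ⊔ Δ.map (M : V.State →ₗ[ℝ] V.State) ≤ Δ := by
    refine Submodule.sup_map_le_of_invariant hUΔ hMU fun d hd => ?_
    rw [← hsplit d]
    exact Submodule.add_mem _
      (sum_inputRel_projection_mem K hPrel d _ fun q hq => hbump q hq d hd)
      (Submodule.mem_sup_left (hπ'U d hd))
  have hall : ∀ q, ∀ d ∈ Δ, V.nodeProjection (K.InputRel q) d ∈ Δ := fun q d hd => by
    by_cases hq : P q
    · exact hle (hbump q hq d hd)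
    · exact apply_nodeProjection_mem (N := ContinuousLinearMap.id ℝ _) hT hγc hpat hresp
        (claim 0).1 (hnP q hq) hd
  intro c d hcd
  by_contra hcon
  -- All coordinates are 1, so `o` is in `Δ`. Its projection to the class of `c` is nonzero at `c`
  -- and zero at `d`, hence cannot be in `Δ`.
  let o : V.State := fun i => WithLp.toLp 2 fun _ => 1
  have ho : o ∈ Δ := fun i j hij => ⟨K.stateEquiv _ _ hij, rfl⟩
  obtain ⟨h2, h3⟩ := hall c o ho c d hcd
  rw [nodeProjection_of_pos _ (Colouring.InputRel.refl c),
    nodeProjection_of_neg _ fun h => hcon h.2] at h3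
  have h4 : o c = 0 := by simpa using h3
  have h5 := congrArg (fun u : V.Space c => u ⟨0, V.dim_pos c⟩) h4
  simp [o] at h5

omit [Finite A] [Fintype C] in
/-- The polydiagonal of a balanced colouring is invariant under admissible maps. -/
theorem IsAdmissible.mem_polydiagonal (hf : V.IsAdmissible f) (hK : K.IsBalanced) {x : V.State}
    (hx : x ∈ V.polydiagonalSubmodule K) : f x ∈ V.polydiagonalSubmodule K := fun c d hcd => by
  obtain ⟨β, hβ⟩ := hK c d hcd
  exact hf.synchronous β ((V.pullback_inputState_eq_iff β x).2
    ⟨hx _ _ hcd, fun e => hx _ _ (hβ e)⟩)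

end NodeSpaces

end Network

/-! ### Flow-invariance and the conclusion -/

/-- A solution that starts in an invariant linear subspace of a `C¹` vector field stays in it. -/
theorem mem_submodule_of_hasDerivAt {E : Type*} [NormedAddCommGroup E] [NormedSpace ℝ E]
    [FiniteDimensional ℝ E] {f : E → E} (hf : ContDiff ℝ 1 f) {W : Submodule ℝ E}
    (hW : ∀ z ∈ W, f z ∈ W) {x : ℝ → E} (hx : ∀ t, HasDerivAt x (f (x t)) t) {a : ℝ}
    (ha : x a ∈ W) {t : ℝ} (ht : a ≤ t) : x t ∈ W := by
  obtain ⟨g, hg⟩ := LinearMap.exists_leftInverse_of_injective W.subtype W.ker_subtype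
  set Q : E →L[ℝ] E := (W.subtype ∘ₗ g).toContinuousLinearMap with hQ
  have hQmem : ∀ z, Q z ∈ W := fun z => (g z).2
  have hQid : ∀ z ∈ W, Q z = z := fun z hz =>
    congrArg Subtype.val (LinearMap.congr_fun hg ⟨z, hz⟩)
  set R : E →L[ℝ] E := ContinuousLinearMap.id ℝ E - Q with hR
  have hRz : ∀ z, R z = z - Q z := fun z => rfl
  have hxc : Continuous x := continuous_iff_continuousAt.2 fun t => (hx t).continuousAt
  have hcomp : IsCompact (x '' Icc a t ∪ (fun r => Q (x r)) '' Icc a t) :=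
    (isCompact_Icc.image hxc).union (isCompact_Icc.image (Q.continuous.comp hxc))
  obtain ⟨k, hk⟩ := hf.locallyLipschitz.locallyLipschitzOn.exists_lipschitzOnWith_of_compact hcomp
  -- Grönwall for the distance `R x = x - Q x` to the projection: `R f(Q x) = 0` by invariance, so
  -- `R f(x)` is bounded by a multiple of `R x`.
  have hzero := eq_zero_of_abs_deriv_le_mul_abs_self_of_eq_zero_right
    (f := fun r => R (x r)) (f' := fun r => R (f (x r))) (K := ‖R‖ * k) (a := a) (b := t)
    (R.continuous.comp hxc).continuousOn
    (fun r _ => (R.hasFDerivAt.comp_hasDerivAt r (hx r)).hasDerivWithinAt)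
    (by simp only [hRz, hQid _ ha, sub_self])
    (fun r hr => by
      have hr' := Ico_subset_Icc_self hr
      have h1 : R (f (x r)) = R (f (x r) - f (Q (x r))) := by
        rw [map_sub, hRz (f (Q (x r))), hQid _ (hW _ (hQmem _)), sub_self, sub_zero]
      rw [h1, mul_assoc]
      refine (R.le_opNorm _).trans (mul_le_mul_of_nonneg_left ?_ (norm_nonneg _))
      exact hk.norm_sub_le (Or.inl (mem_image_of_mem x hr'))
        (Or.inr (mem_image_of_mem (fun r => Q (x r)) hr')))
    t ⟨ht, le_rfl⟩
  have h2 : x t = Q (x t) := sub_eq_zero.1 hzero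
  rw [h2]
  exact hQmem _

end

theorem corollary10p3 {C A : Type*} [Fintype C] [DecidableEq C] [Finite A]
    (G : Network C A) (V : G.NodeSpaces)
    (f : V.State → V.State) (hf : V.IsAdmissible f) (hf_smooth : ContDiff ℝ ∞ f)
    (x : ℝ → V.State) (T : ℝ) (hx : V.IsStronglyHyperbolic f x T)
    (K : G.Colouring) (t₀ : ℝ) (hK : V.IsLocallyRigidSynchronyPattern K f x T t₀) :
    V.IsGlobalSynchronyPattern K x ∧ K.IsBalanced := by
  have hhyp : IsHyperbolicPeriodicOrbit f x T := (hx K).1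
  have hper := hhyp.1
  obtain ⟨s₀, h0, hpat, B, hresp⟩ := hK.exists_responses hf_smooth hhyp
  have hbal : K.IsBalanced := by
    refine Network.NodeSpaces.isBalanced_of_responses hf (hf_smooth.differentiable (by simp))
      hper.pos (fun s => ?_) h0 (fun s hs => hpat s ⟨hs.1.le, hs.2⟩) hresp
    have h1 : HasDerivAt (fun s : ℝ => t₀ + T * s) T s := by
      simpa using ((hasDerivAt_id s).const_mul T).const_add t₀
    exact (hper.solution (t₀ + T * s)).scomp s h1
  have hpat₀ : ∀ c d, V.Synchronous (x t₀) c d ↔ K.rel c d := by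
    simpa using hpat 0 ⟨le_rfl, h0⟩
  refine ⟨fun c d => ⟨fun hcd t => ?_, fun h => (hpat₀ c d).1 (h t₀)⟩, hbal⟩
  -- Invariance is used forward from `t₀`, so `t` is first shifted by whole periods beyond `t₀`.
  obtain ⟨n, hn⟩ := exists_nat_gt ((t₀ - t) / T)
  have hle : t₀ ≤ t + n * T := by
    have := (div_lt_iff₀ hper.pos).1 hn
    linarith
  have hmem := mem_submodule_of_hasDerivAt (hf_smooth.of_le (by simp))
    (W := V.polydiagonalSubmodule K) (fun z hz => hf.mem_polydiagonal hbal hz) hper.solution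
    (fun c d hcd => (hpat₀ c d).2 hcd) hle
  have hperiod : x (t + n * T) = x t :=
    Function.Periodic.nat_mul (f := x) (c := T) hper.periodic n t
  rw [hperiod] at hmem
  exact hmem c d hcd
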